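/- Let $\Omega=I\times J\subset\mathbb R^2$ be an open rectangle and let $K=(\psi,\Omega)$ be a K-surface, i.e. a smooth immersion $\psi:\Omega\to\mathbb R^3$ of constant Gaussian curvature $-1$. Let $(E_1,E_3)$ be a K-frame on $K$: smooth, linearly independent vector fields on $\Omega$ that at each point are asymptotic directions of $\psi$ and satisfy $|d\psi(E_1)|=|d\psi(E_3)|=1$. Let $(\theta^1,\theta^3)$ be the dual coframe (the K-coframe) and $\omega\in(0,\pi)$ the angle between $d\psi(E_1)$ and $d\psi(E_3)$. Let $\nu$ be the smooth unit normal field of $\psi$ on the side for which $II_K(E_1,E_3)>0$, and let $\varepsilon\in\{1,-1\}$ be the orientation sign of the triple $(d\psi(E_3),d\psi(E_1),\nu)$. Let $V=(\eta,\Omega)$ be a smooth immersion that is a rotation field of $K$: there are smooth $\xi,\zeta:\Omega\to\mathbb R^3$ such that $\xi$ is an infinitesimal isometric deformation of $\psi$, i.e. $\langle d\xi(X),d\psi(Y)\rangle+\langle d\xi(Y),d\psi(X)\rangle=0$ for all $X,Y$, and $\xi=\eta\times\psi+\zeta$, $d\xi=\eta\times d\psi$, $d\zeta=\psi\times d\eta$.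 Then $\nu$ is also a unit normal field of $\eta$ (and $II_V$, $\mathrm H_V$ below are taken with respect to it), $\omega\in C^\infty(\Omega)$, and there are nowhere vanishing $b,c\in C^\infty(\Omega)$ such that the rotation operator $A=d\psi^{-1}\circ d\eta$ is well defined and equals $A=b\,E_1\otimes\theta^3+c\,E_3\otimes\theta^1$, and the following hold on $\Omega$. (1) With $\theta^1\odot\theta^3=\tfrac12(\theta^1\otimes\theta^3+\theta^3\otimes\theta^1)$, $$I_V=c^2\,\theta^1\otimes\theta^1+2bc\cos(\omega)\,\theta^1\odot\theta^3+b^2\,\theta^3\otimes\theta^3,\qquad II_V=\sin(\omega)\,\bigl(c\,\theta^1\otimes\theta^1+b\,\theta^3\otimes\theta^3\bigr).$$ (2) The Codazzi equations $$-db(E_1)=c\csc(\omega)\,d\omega(E_3)+b\cot(\omega)\,d\omega(E_1),\qquad -dc(E_3)=c\cot(\omega)\,d\omega(E_3)+b\csc(\omega)\,d\omega(E_1)$$ and the Gauss (sine-Gordon) equation $\operatorname{Hess}\omega(E_1,E_3)=\sin\omega$ hold, where $\operatorname{Hess}$ is the Hessian of the metric $I_K$; moreover $E_1(E_3\,\omega)=\sin\omega$.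 (3) Let $\bar E_i=E_i/|d\eta(E_i)|$, $i=1,3$, be the induced V-frame. The images under $\eta$ of the integral curves of $\bar E_1$ and of $\bar E_3$ (the V-net lines) are unit speed geodesics of $V$, i.e. $\gamma''=\kappa_i\nu$, with signed curvatures $\kappa_i$ with respect to $\nu$ (so their curvatures as space curves are $|\kappa_i|$) and torsions $\tau_i$ given by $$\kappa_1=c^{-1}\sin\omega,\qquad \tau_1=-\varepsilon\,c^{-1}\cos\omega,\qquad \kappa_3=b^{-1}\sin\omega,\qquad \tau_3=\varepsilon\,b^{-1}\cos\omega .$$ Here the torsion of a space curve is $\langle\gamma'\times\gamma'',\gamma'''\rangle/|\gamma'\times\gamma''|^2$. (4) The mean and Gaussian curvatures of $V$ are $$\mathrm H_V=\frac{b+c}{2\,bc\,\sin\omega},\qquad \mathrm K_V=\frac1{bc}.$$ -/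

import Mathlib

noncomputable section

namespace VossSurface

open scoped ContDiff

/-- Euclidean three-space. -/
abbrev Space : Type := EuclideanSpace ℝ (Fin 3)

/-- The cross product of Euclidean three-space. -/
def cross (x y : Space) : Space :=
  WithLp.toLp 2 (crossProduct (WithLp.ofLp x) (WithLp.ofLp y))

/-- Parameter domains: open rectangles `I × J`, with `I`, `J` nonempty open intervals (bounded or
not). -/
def IsOpenRectangle (Ω : Set (ℝ × ℝ)) : Prop :=
  ∃ I J : Set ℝ, IsOpen I ∧ I.OrdConnected ∧ I.Nonempty ∧
    IsOpen J ∧ J.OrdConnected ∧ J.Nonempty ∧ Ω = I ×ˢ J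

/-- `(f, Ω)` is (a representative of) a surface element: a smooth immersion of an open rectangle
into three-space. -/
structure IsSurfaceElement (f : ℝ × ℝ → Space) (Ω : Set (ℝ × ℝ)) : Prop where
  rectangle : IsOpenRectangle Ω
  smooth : ContDiffOn ℝ ∞ f Ω
  immersion : ∀ p ∈ Ω, Function.Injective (fderiv ℝ f p)

/-- `ν` is a smooth unit normal field along `(f, Ω)`. -/
structure IsUnitNormal (f ν : ℝ × ℝ → Space) (Ω : Set (ℝ × ℝ)) : Prop where
  smooth : ContDiffOn ℝ ∞ ν Ω
  unit : ∀ p ∈ Ω, ‖ν p‖ = 1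
  normal : ∀ p ∈ Ω, ∀ X : ℝ × ℝ, inner ℝ (fderiv ℝ f p X) (ν p) = 0

/-- First fundamental form `I_f (X, Y) = ⟨df X, df Y⟩` at `p`. -/
def firstForm (f : ℝ × ℝ → Space) (p X Y : ℝ × ℝ) : ℝ :=
  inner ℝ (fderiv ℝ f p X) (fderiv ℝ f p Y)

/-- Second fundamental form `II_f (X, Y) = ⟨D²f (X, Y), ν⟩` at `p`, with respect to the
unit normal field `ν`. -/
def secondForm (f ν : ℝ × ℝ → Space) (p X Y : ℝ × ℝ) : ℝ :=
  inner ℝ (fderiv ℝ (fderiv ℝ f) p X Y) (ν p)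

/-- The determinant `E G - F ^ 2` of the first fundamental form in the coordinate frame. -/
def firstDet (f : ℝ × ℝ → Space) (p : ℝ × ℝ) : ℝ :=
  firstForm f p (1, 0) (1, 0) * firstForm f p (0, 1) (0, 1) - firstForm f p (1, 0) (0, 1) ^ 2

/-- Gaussian curvature `det II / det I`. -/
def gaussCurvature (f ν : ℝ × ℝ → Space) (p : ℝ × ℝ) : ℝ :=
  (secondForm f ν p (1, 0) (1, 0) * secondForm f ν p (0, 1) (0, 1)
    - secondForm f ν p (1, 0) (0, 1) ^ 2) / firstDet f p

/-- Mean curvature `(1/2) tr (I⁻¹ II)`, with respect to the unit normal field `ν`. -/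
def meanCurvature (f ν : ℝ × ℝ → Space) (p : ℝ × ℝ) : ℝ :=
  (secondForm f ν p (1, 0) (1, 0) * firstForm f p (0, 1) (0, 1)
    - 2 * secondForm f ν p (1, 0) (0, 1) * firstForm f p (1, 0) (0, 1)
    + secondForm f ν p (0, 1) (0, 1) * firstForm f p (1, 0) (1, 0)) / (2 * firstDet f p)

/-- `(ψ, Ω)`, with unit normal field `ν`, is a K-surface: a surface element of constant
Gaussian curvature `-1`. -/
structure IsKSurface (ψ ν : ℝ × ℝ → Space) (Ω : Set (ℝ × ℝ)) : Prop where
  surface : IsSurfaceElement ψ Ω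
  normal : IsUnitNormal ψ ν Ω
  curvature : ∀ p ∈ Ω, gaussCurvature ψ ν p = -1

/-- `ξ` is an infinitesimal isometric deformation of `(ψ, Ω)`. -/
structure IsInfinitesimalIsometry (ψ ξ : ℝ × ℝ → Space) (Ω : Set (ℝ × ℝ)) : Prop where
  smooth : ContDiffOn ℝ ∞ ξ Ω
  isometric : ∀ p ∈ Ω, ∀ X Y : ℝ × ℝ,
    inner ℝ (fderiv ℝ ξ p X) (fderiv ℝ ψ p Y) + inner ℝ (fderiv ℝ ξ p Y) (fderiv ℝ ψ p X) = 0

/-- `η` is a rotation field of `(ψ, Ω)`: for some infinitesimal isometric deformation `ξ` with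
translation field `ζ`, one has `ξ = η × ψ + ζ`, `dξ = η × dψ` and `dζ = ψ × dη`. -/
def IsRotationField (ψ η : ℝ × ℝ → Space) (Ω : Set (ℝ × ℝ)) : Prop :=
  ContDiffOn ℝ ∞ η Ω ∧
  ∃ ξ ζ : ℝ × ℝ → Space,
    IsInfinitesimalIsometry ψ ξ Ω ∧ ContDiffOn ℝ ∞ ζ Ω ∧
    ∀ p ∈ Ω, ξ p = cross (η p) (ψ p) + ζ p ∧
      ∀ X : ℝ × ℝ, fderiv ℝ ξ p X = cross (η p) (fderiv ℝ ψ p X) ∧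
        fderiv ℝ ζ p X = cross (ψ p) (fderiv ℝ η p X)

/-- `(E₁, E₃)` is a K-frame of `(ψ, Ω)`: a smooth frame of linearly independent asymptotic
vector fields of unit length in the first fundamental form. The unit normal `ν` is taken on the
side for which `II (E₁, E₃)` is positive. -/
structure IsKFrame (ψ ν : ℝ × ℝ → Space) (E₁ E₃ : ℝ × ℝ → ℝ × ℝ) (Ω : Set (ℝ × ℝ)) :
    Prop where
  smooth_one : ContDiffOn ℝ ∞ E₁ Ω
  smooth_three : ContDiffOn ℝ ∞ E₃ Ω
  independent : ∀ p ∈ Ω, LinearIndependent ℝ ![E₁ p, E₃ p]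
  unit_one : ∀ p ∈ Ω, firstForm ψ p (E₁ p) (E₁ p) = 1
  unit_three : ∀ p ∈ Ω, firstForm ψ p (E₃ p) (E₃ p) = 1
  asymptotic_one : ∀ p ∈ Ω, secondForm ψ ν p (E₁ p) (E₁ p) = 0
  asymptotic_three : ∀ p ∈ Ω, secondForm ψ ν p (E₃ p) (E₃ p) = 0
  side : ∀ p ∈ Ω, 0 < secondForm ψ ν p (E₁ p) (E₃ p)

/-- `(θ₁, θ₃)` is the coframe dual to the frame `(E₁, E₃)` on `Ω`. -/
def IsDualCoframe (E₁ E₃ : ℝ × ℝ → ℝ × ℝ) (θ₁ θ₃ : ℝ × ℝ → (ℝ × ℝ) →L[ℝ] ℝ)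
    (Ω : Set (ℝ × ℝ)) : Prop :=
  ∀ p ∈ Ω, θ₁ p (E₁ p) = 1 ∧ θ₁ p (E₃ p) = 0 ∧ θ₃ p (E₁ p) = 0 ∧ θ₃ p (E₃ p) = 1

/-- The symmetric product `α ⊙ β = (1/2) (α ⊗ β + β ⊗ α)`, evaluated at `(X, Y)`. -/
def symProd (α β : (ℝ × ℝ) →L[ℝ] ℝ) (X Y : ℝ × ℝ) : ℝ :=
  (1 / 2) * (α X * β Y + β X * α Y)

/-- The angle between the vector fields `df (X)` and `df (Y)`, in `[0, π]`. -/
def frameAngle (f : ℝ × ℝ → Space) (X Y : ℝ × ℝ → ℝ × ℝ) (p : ℝ × ℝ) : ℝ :=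
  InnerProductGeometry.angle (fderiv ℝ f p (X p)) (fderiv ℝ f p (Y p))

/-- For an immersion `f`: the tangent vector `Z` at `p` whose image `df (Z)` is the orthogonal
projection of `w` to the tangent plane (so `df⁻¹ w` if `w` is tangential). -/
def tangentPart (f : ℝ × ℝ → Space) (p : ℝ × ℝ) (w : Space) : ℝ × ℝ :=
  ((firstForm f p (0, 1) (0, 1) * inner ℝ w (fderiv ℝ f p (1, 0))
      - firstForm f p (1, 0) (0, 1) * inner ℝ w (fderiv ℝ f p (0, 1))) / firstDet f p,
   (firstForm f p (1, 0) (1, 0) * inner ℝ w (fderiv ℝ f p (0, 1))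
      - firstForm f p (1, 0) (0, 1) * inner ℝ w (fderiv ℝ f p (1, 0))) / firstDet f p)

/-- The Levi-Civita derivative `∇_X Y` of the first fundamental form of `f`: the tangential part
of `D_X (df Y)`. -/
def covDeriv (f : ℝ × ℝ → Space) (X Y : ℝ × ℝ → ℝ × ℝ) (p : ℝ × ℝ) : ℝ × ℝ :=
  tangentPart f p (fderiv ℝ (fun q => fderiv ℝ f q (Y q)) p (X p))

/-- The Hessian `Hess h (X, Y) = X (Y h) - (∇_X Y) h` for the first fundamental form of `f`. -/
def hessian (f : ℝ × ℝ → Space) (h : ℝ × ℝ → ℝ) (X Y : ℝ × ℝ → ℝ × ℝ) (p : ℝ × ℝ) : ℝ :=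
  fderiv ℝ (fun q => fderiv ℝ h q (Y q)) p (X p) - fderiv ℝ h p (covDeriv f X Y p)

/-- The rotation operator `A = dψ⁻¹ ∘ dη`. -/
def rotationOperator (ψ η : ℝ × ℝ → Space) (p X : ℝ × ℝ) : ℝ × ℝ :=
  tangentPart ψ p (fderiv ℝ η p X)

/-- A field of the V-frame induced on `η`: the vector field `E`, rescaled by a positive factor to
unit length in the first fundamental form of `η`. -/
def vFrame (η : ℝ × ℝ → Space) (E : ℝ × ℝ → ℝ × ℝ) (p : ℝ × ℝ) : ℝ × ℝ :=
  ‖fderiv ℝ η p (E p)‖⁻¹ • E p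

/-- Curvature of a space curve, `|γ' × γ''| / |γ'| ^ 3`. -/
def curvature (γ : ℝ → Space) (s : ℝ) : ℝ :=
  ‖cross (deriv γ s) (deriv (deriv γ) s)‖ / ‖deriv γ s‖ ^ 3

/-- Torsion of a space curve, `⟨γ' × γ'', γ'''⟩ / |γ' × γ''| ^ 2`. -/
def torsion (γ : ℝ → Space) (s : ℝ) : ℝ :=
  inner ℝ (cross (deriv γ s) (deriv (deriv γ) s)) (deriv (deriv (deriv γ)) s)
    / ‖cross (deriv γ s) (deriv (deriv γ) s)‖ ^ 2

/-- Along every integral curve in `Ω` of the vector field `F`, the image curve under `η` is at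
each point of unit speed, is a geodesic of `η` with signed curvature `κ` with respect to its
principal normal `ν` (so its curvature as a space curve is `|κ|`), and has torsion `τ`. -/
def NetLinesHave (η ν : ℝ × ℝ → Space) (F : ℝ × ℝ → ℝ × ℝ) (Ω : Set (ℝ × ℝ))
    (κ τ : ℝ × ℝ → ℝ) : Prop :=
  ∀ (α : ℝ → ℝ × ℝ) (s : ℝ), α s ∈ Ω → IsIntegralCurveAt α (fun _ => F) s →
    ‖deriv (η ∘ α) s‖ = 1 ∧
    deriv (deriv (η ∘ α)) s = κ (α s) • ν (α s) ∧
    curvature (η ∘ α) s = |κ (α s)| ∧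
    torsion (η ∘ α) s = τ (α s)

end VossSurface

end

open VossSurface

/-!
Write `e₁ = dψ (E₁)`, `e₃ = dψ (E₃)`, and let `s = sin ω`. Everything is read off in the frame
`(e₁, e₃, ν)`, in which vectors are determined by their scalar products (`IsAsymptoticNet.ext`).

The K-surface. In the asymptotic frame `K = -1` says `II (E₁, E₃) ^ 2 = 1 - cos² ω`, so
`II (E₁, E₃) = s > 0` (`secondForm_one_three`); this keeps `ω` inside `(0, π)`, and
`ω = arccos ⟨e₁, e₃⟩` is smooth. Equality of the mixed derivatives of `ψ` and of `ν` forces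
`[E₁, E₃] = 0` (`bracket_eq_zero`), the Chebyshev property of the asymptotic net, and then
`E₁ e₃ = E₃ e₁ = s ν` (`along_one_three`). Differentiating `e₁` in both orders gives
`E₃ (E₁ ω) = s` (`sine_gordon`); the Hessian adds nothing because the tangential part of `E₁ e₃`
vanishes.

The rotation field. Equality of the mixed derivatives of `ξ`, where `dξ = η × dψ`, says
`dη (E₁) × e₃ = dη (E₃) × e₁` (`cross_comm`). This makes `dη` tangential to `ψ` with a trace-free
rotation operator; the symmetry of the second fundamental form of `η` then makes its diagonal
entries equal, hence zero. So `dη (E₁) = c e₃` and `dη (E₃) = b e₁` (`along_one_eq`), which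
determines both fundamental forms and the curvatures of `η`, and `E₁ (b e₁) = E₃ (c e₃)` is the
pair of Codazzi equations (`codazzi`).

The net lines. Along a line of the first family the unit tangent is `± e₃`, whose derivative is
a multiple of `ν` because `E₁ e₃ = s ν`; the torsion follows from the Weingarten equation for
`E₁ ν` (`netLinesHave`).

All notions are symmetric under interchange of the two families (`swap`), so each equation is
proved for one family only; the interchange reverses the orientation sign `ε`.
-/

namespace VossSurface

open scoped Topology

local notation "∞" => ((⊤ : ℕ∞) : WithTop ℕ∞)

/-! ### The cross product -/

theorem inner_eq_sum (x y : Space) : inner ℝ x y = x 0 * y 0 + x 1 * y 1 + x 2 * y 2 := by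
  simp [PiLp.inner_apply, Fin.sum_univ_three, mul_comm]

theorem cross_apply_zero (x y : Space) : cross x y 0 = x 1 * y 2 - x 2 * y 1 := by
  simp [cross, cross_apply]

theorem cross_apply_one (x y : Space) : cross x y 1 = x 2 * y 0 - x 0 * y 2 := by
  simp [cross, cross_apply]

theorem cross_apply_two (x y : Space) : cross x y 2 = x 0 * y 1 - x 1 * y 0 := by
  simp [cross, cross_apply]

theorem inner_cross_self_left (x y : Space) : inner ℝ (cross x y) x = 0 := by
  simp only [inner_eq_sum, cross_apply_zero, cross_apply_one, cross_apply_two]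
  ring

theorem inner_cross_self_right (x y : Space) : inner ℝ (cross x y) y = 0 := by
  simp only [inner_eq_sum, cross_apply_zero, cross_apply_one, cross_apply_two]
  ring

theorem inner_cross_rotate (x y z : Space) : inner ℝ (cross x y) z = inner ℝ (cross y z) x := by
  simp only [inner_eq_sum, cross_apply_zero, cross_apply_one, cross_apply_two]
  ring

theorem inner_cross_swap (x y z : Space) : inner ℝ (cross x y) z = -inner ℝ (cross y x) z := by
  simp only [inner_eq_sum, cross_apply_zero, cross_apply_one, cross_apply_two]
  ring

theorem inner_cross_cross (x y z w : Space) : inner ℝ (cross x y) (cross z w) =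
    inner ℝ x z * inner ℝ y w - inner ℝ x w * inner ℝ y z := by
  simp only [inner_eq_sum, cross_apply_zero, cross_apply_one, cross_apply_two]
  ring

theorem cross_smul_left (r : ℝ) (x y : Space) : cross (r • x) y = r • cross x y := by
  simp [cross]

theorem cross_smul_right (r : ℝ) (x y : Space) : cross x (r • y) = r • cross x y := by
  simp [cross]

theorem cross_add_left (x y z : Space) : cross (x + y) z = cross x z + cross y z := by
  simp [cross]

theorem cross_add_right (x y z : Space) : cross x (y + z) = cross x y + cross x z := by
  simp [cross]

/-- The cross product as a continuous bilinear map. -/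
noncomputable def crossL : Space →L[ℝ] Space →L[ℝ] Space :=
  (LinearMap.mk₂ ℝ cross cross_add_left cross_smul_left cross_add_right
    cross_smul_right).toContinuousBilinearMap

/-! ### Derivatives along vector fields -/

section Calculus

variable {V : Type*} [NormedAddCommGroup V] [NormedSpace ℝ V] {Ω : Set (ℝ × ℝ)} {p : ℝ × ℝ}

theorem IsOpenRectangle.isOpen (h : IsOpenRectangle Ω) : IsOpen Ω := by
  obtain ⟨I, J, hI, -, -, hJ, -, -, rfl⟩ := h
  exact hI.prod hJ

theorem IsOpenRectangle.isPreconnected (h : IsOpenRectangle Ω) : IsPreconnected Ω := by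
  obtain ⟨I, J, -, hI, -, -, hJ, -, rfl⟩ := h
  exact hI.isPreconnected.prod hJ.isPreconnected

theorem _root_.ContDiffOn.differentiableAt_of_isOpen {F : ℝ × ℝ → V} (hF : ContDiffOn ℝ ∞ F Ω)
    (hΩ : IsOpen Ω) (hp : p ∈ Ω) : DifferentiableAt ℝ F p :=
  (hF.contDiffAt (hΩ.mem_nhds hp)).differentiableAt (by simp)

/-- The derivative of a map along a vector field. -/
noncomputable def along (X : ℝ × ℝ → ℝ × ℝ) (F : ℝ × ℝ → V) : ℝ × ℝ → V :=
  fun q => fderiv ℝ F q (X q)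

theorem _root_.ContDiffOn.along {F : ℝ × ℝ → V} {X : ℝ × ℝ → ℝ × ℝ}
    (hF : ContDiffOn ℝ ∞ F Ω) (hX : ContDiffOn ℝ ∞ X Ω) (hΩ : IsOpen Ω) :
    ContDiffOn ℝ ∞ (along X F) Ω :=
  (hF.fderiv_of_isOpen hΩ (by simp)).clm_apply hX

theorem along_along {F : ℝ × ℝ → V} {Y : ℝ × ℝ → ℝ × ℝ} (hF : ContDiffOn ℝ ∞ F Ω)
    (hY : ContDiffOn ℝ ∞ Y Ω) (hΩ : IsOpen Ω) (hp : p ∈ Ω) (X : ℝ × ℝ → ℝ × ℝ) :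
    along X (along Y F) p =
      fderiv ℝ (fderiv ℝ F) p (X p) (Y p) + fderiv ℝ F p (fderiv ℝ Y p (X p)) := by
  have h : ContDiffOn ℝ ∞ (fderiv ℝ F) Ω := hF.fderiv_of_isOpen hΩ (by simp)
  unfold along
  rw [fderiv_clm_apply (h.differentiableAt_of_isOpen hΩ hp)
    (hY.differentiableAt_of_isOpen hΩ hp)]
  simp [add_comm]

theorem fderiv_fderiv_symm {F : ℝ × ℝ → V} (hF : ContDiffOn ℝ ∞ F Ω) (hΩ : IsOpen Ω)
    (hp : p ∈ Ω) (v w : ℝ × ℝ) :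
    fderiv ℝ (fderiv ℝ F) p v w = fderiv ℝ (fderiv ℝ F) p w v :=
  (hF.contDiffAt (hΩ.mem_nhds hp)).isSymmSndFDerivAt
    (by
      rw [minSmoothness_of_isRCLikeNormedField]
      exact WithTop.coe_le_coe.mpr (le_top : (2 : ℕ∞) ≤ ⊤)) v w

/-- The Lie bracket `[X, Y]` of two vector fields on the plane, in coordinates. -/
noncomputable def bracket (X Y : ℝ × ℝ → ℝ × ℝ) (p : ℝ × ℝ) : ℝ × ℝ :=
  fderiv ℝ Y p (X p) - fderiv ℝ X p (Y p)

theorem bracket_swap (X Y : ℝ × ℝ → ℝ × ℝ) (p : ℝ × ℝ) : bracket Y X p = -bracket X Y p := by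
  simp [bracket]

theorem fderiv_bracket {F : ℝ × ℝ → V} {X Y : ℝ × ℝ → ℝ × ℝ}
    (hF : ContDiffOn ℝ ∞ F Ω) (hX : ContDiffOn ℝ ∞ X Ω) (hY : ContDiffOn ℝ ∞ Y Ω)
    (hΩ : IsOpen Ω) (hp : p ∈ Ω) :
    fderiv ℝ F p (bracket X Y p) = along X (along Y F) p - along Y (along X F) p := by
  rw [along_along hF hY hΩ hp, along_along hF hX hΩ hp,
    fderiv_fderiv_symm hF hΩ hp (X p) (Y p), bracket, map_sub]
  abel

theorem along_congr {F G : ℝ × ℝ → V} (h : ∀ q ∈ Ω, F q = G q) (hΩ : IsOpen Ω)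
    (hp : p ∈ Ω) (X : ℝ × ℝ → ℝ × ℝ) : along X F p = along X G p :=
  DFunLike.congr_fun
    (Filter.EventuallyEq.fderiv_eq (Filter.eventually_of_mem (hΩ.mem_nhds hp) h)) (X p)

theorem along_const (X : ℝ × ℝ → ℝ × ℝ) (v : V) (p : ℝ × ℝ) : along X (fun _ => v) p = 0 := by
  simp [along]

/-- Leibniz rule for a scalar product that is a known function on an open set. -/
theorem along_inner {F G : ℝ × ℝ → Space} {h : ℝ × ℝ → ℝ} (hF : ContDiffOn ℝ ∞ F Ω)
    (hG : ContDiffOn ℝ ∞ G Ω) (hh : ∀ q ∈ Ω, inner ℝ (F q) (G q) = h q) (hΩ : IsOpen Ω)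
    (hp : p ∈ Ω) (X : ℝ × ℝ → ℝ × ℝ) :
    inner ℝ (along X F p) (G p) + inner ℝ (F p) (along X G p) = along X h p := by
  rw [← along_congr hh hΩ hp]
  simp only [along]
  rw [fderiv_inner_apply ℝ
    (hF.differentiableAt_of_isOpen hΩ hp) (hG.differentiableAt_of_isOpen hΩ hp), add_comm]

theorem inner_along_self {F : ℝ × ℝ → Space} (hF : ContDiffOn ℝ ∞ F Ω)
    (hh : ∀ q ∈ Ω, inner ℝ (F q) (F q) = (1 : ℝ)) (hΩ : IsOpen Ω) (hp : p ∈ Ω)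
    (X : ℝ × ℝ → ℝ × ℝ) : inner ℝ (along X F p) (F p) = 0 := by
  have h := along_inner hF hF hh hΩ hp X
  rw [along_const, real_inner_comm (along X F p)] at h
  linarith

theorem along_smul {f : ℝ × ℝ → ℝ} {F : ℝ × ℝ → V} (hf : ContDiffOn ℝ ∞ f Ω)
    (hF : ContDiffOn ℝ ∞ F Ω) (hΩ : IsOpen Ω) (hp : p ∈ Ω) (X : ℝ × ℝ → ℝ × ℝ) :
    along X (fun q => f q • F q) p = f p • along X F p + along X f p • F p := by
  simp only [along]
  rw [fderiv_fun_smul (hf.differentiableAt_of_isOpen hΩ hp)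
    (hF.differentiableAt_of_isOpen hΩ hp)]
  simp

theorem along_mul {f g : ℝ × ℝ → ℝ} (hf : ContDiffOn ℝ ∞ f Ω)
    (hg : ContDiffOn ℝ ∞ g Ω) (hΩ : IsOpen Ω) (hp : p ∈ Ω) (X : ℝ × ℝ → ℝ × ℝ) :
    along X (fun q => f q * g q) p = f p * along X g p + along X f p * g p :=
  along_smul hf hg hΩ hp X

theorem along_cos {f : ℝ × ℝ → ℝ} (hf : ContDiffOn ℝ ∞ f Ω) (hΩ : IsOpen Ω) (hp : p ∈ Ω)
    (X : ℝ × ℝ → ℝ × ℝ) :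
    along X (fun q => Real.cos (f q)) p = -(Real.sin (f p) * along X f p) := by
  simp [along, (hf.differentiableAt_of_isOpen hΩ hp).hasFDerivAt.cos.fderiv]

theorem along_sin {f : ℝ × ℝ → ℝ} (hf : ContDiffOn ℝ ∞ f Ω) (hΩ : IsOpen Ω) (hp : p ∈ Ω)
    (X : ℝ × ℝ → ℝ × ℝ) :
    along X (fun q => Real.sin (f q)) p = Real.cos (f p) * along X f p := by
  simp [along, (hf.differentiableAt_of_isOpen hΩ hp).hasFDerivAt.sin.fderiv]

theorem along_neg (f : ℝ × ℝ → ℝ) (X : ℝ × ℝ → ℝ × ℝ) (p : ℝ × ℝ) :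
    along X (fun q => -f q) p = -along X f p := by
  simp [along]

end Calculus

/-! ### Linear algebra of frames -/

theorem exists_eq_smul_add_smul {u v : ℝ × ℝ} (h : LinearIndependent ℝ ![u, v]) (X : ℝ × ℝ) :
    ∃ s t : ℝ, X = s • u + t • v := by
  have hX : X ∈ Submodule.span ℝ (Set.range ![u, v]) := by
    rw [h.span_eq_top_of_card_eq_finrank' (by simp)]
    trivial
  rw [Matrix.range_cons, Matrix.range_cons, Matrix.range_empty, Set.union_empty,
    Set.singleton_union, Submodule.mem_span_pair] at hX
  obtain ⟨s, t, h⟩ := hX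
  exact ⟨s, t, h.symm⟩

/-- A vector of the plane, expanded in a frame by means of the dual coframe. -/
theorem IsDualCoframe.expand {E₁ E₃ : ℝ × ℝ → ℝ × ℝ} {θ₁ θ₃ : ℝ × ℝ → (ℝ × ℝ) →L[ℝ] ℝ}
    {Ω : Set (ℝ × ℝ)} (hθ : IsDualCoframe E₁ E₃ θ₁ θ₃ Ω) {p : ℝ × ℝ} (hp : p ∈ Ω)
    (hE : LinearIndependent ℝ ![E₁ p, E₃ p]) (X : ℝ × ℝ) :
    X = θ₁ p X • E₁ p + θ₃ p X • E₃ p := by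
  obtain ⟨h1, h2, h3, h4⟩ := hθ p hp
  obtain ⟨s, t, rfl⟩ := exists_eq_smul_add_smul hE X
  simp [h1, h2, h3, h4]

/-- A vector orthogonal to two independent unit vectors and to their common unit normal
vanishes. -/
theorem eq_zero_of_inner_frame {a b n w : Space} {C : ℝ} (ha : inner ℝ a a = 1)
    (hb : inner ℝ b b = 1) (hn : inner ℝ n n = 1) (hab : inner ℝ a b = C)
    (han : inner ℝ a n = 0) (hbn : inner ℝ b n = 0) (hC : C ^ 2 < 1)
    (hwa : inner ℝ w a = 0) (hwb : inner ℝ w b = 0) (hwn : inner ℝ w n = 0) : w = 0 := by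
  have hli : LinearIndependent ℝ ![a, b, n] := by
    rw [Fintype.linearIndependent_iff]
    intro g hg
    simp only [Fin.sum_univ_three, Matrix.cons_val] at hg
    have h1 := congrArg (fun z => inner ℝ z a) hg
    have h2 := congrArg (fun z => inner ℝ z b) hg
    have h3 := congrArg (fun z => inner ℝ z n) hg
    simp only [inner_add_left, inner_smul_left, inner_zero_left, real_inner_comm a b,
      real_inner_comm a n, real_inner_comm b n, ha, hb, hn, hab, han, hbn] at h1 h2 h3
    simp only [conj_trivial] at h1 h2 h3
    have g0 : (1 - C ^ 2) * g 0 = 0 := by linear_combination h1 - C * h2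
    have g1 : (1 - C ^ 2) * g 1 = 0 := by linear_combination h2 - C * h1
    have hne : 1 - C ^ 2 ≠ 0 := by linarith
    intro i
    fin_cases i
    · simpa [hne] using g0
    · simpa [hne] using g1
    · simpa using h3
  have hw : w ∈ Submodule.span ℝ (Set.range ![a, b, n]) := by
    rw [hli.span_eq_top_of_card_eq_finrank' (by simp)]
    trivial
  have : ∀ z ∈ Submodule.span ℝ (Set.range ![a, b, n]), inner ℝ w z = 0 := by
    intro z hz
    induction hz using Submodule.span_induction with
    | mem x hx =>
      obtain ⟨i, rfl⟩ := hx
      fin_cases i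
      · exact hwa
      · exact hwb
      · exact hwn
    | zero => simp
    | add x y _ _ hx hy => rw [inner_add_right, hx, hy, add_zero]
    | smul r x _ hx => rw [inner_smul_right, hx, mul_zero]
  exact inner_self_eq_zero.mp (this w hw)

theorem eq_of_inner_frame {a b n v w : Space} {C : ℝ} (ha : inner ℝ a a = 1)
    (hb : inner ℝ b b = 1) (hn : inner ℝ n n = 1) (hab : inner ℝ a b = C)
    (han : inner ℝ a n = 0) (hbn : inner ℝ b n = 0) (hC : C ^ 2 < 1)
    (hva : inner ℝ v a = inner ℝ w a) (hvb : inner ℝ v b = inner ℝ w b)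
    (hvn : inner ℝ v n = inner ℝ w n) : v = w := by
  rw [← sub_eq_zero]
  apply eq_zero_of_inner_frame ha hb hn hab han hbn hC <;>
    rw [inner_sub_left, sub_eq_zero] <;> assumption

/-- The Gram determinant of an injective differential does not vanish. -/
theorem firstDet_ne_zero {f : ℝ × ℝ → Space} {p : ℝ × ℝ}
    (hf : Function.Injective (fderiv ℝ f p)) : firstDet f p ≠ 0 := by
  intro h
  set u := fderiv ℝ f p (1, 0) with hu
  set v := fderiv ℝ f p (0, 1) with hv
  simp only [firstDet, firstForm, ← hu, ← hv] at h
  -- the Gram determinant times `⟨v, v⟩` is the squared length of this vector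
  have h0 : inner ℝ v v • u - inner ℝ u v • v = 0 := by
    rw [← inner_self_eq_zero (𝕜 := ℝ)]
    simp only [inner_sub_left, inner_sub_right, inner_smul_left, inner_smul_right,
      real_inner_comm u v, conj_trivial]
    linear_combination inner ℝ v v * h
  have h1 : fderiv ℝ f p (inner ℝ v v, -inner ℝ u v) = 0 := by
    have : ((inner ℝ v v, -inner ℝ u v) : ℝ × ℝ) =
        inner ℝ v v • (1, 0) + (-inner ℝ u v) • (0, 1) := by simp
    rw [this, map_add, map_smul, map_smul, ← hu, ← hv, neg_smul, ← sub_eq_add_neg, h0]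
  have h2 := hf (h1.trans (map_zero _).symm)
  have h3 : v = 0 := inner_self_eq_zero.mp (congrArg Prod.fst h2)
  have h4 := hf ((hv.symm.trans h3).trans (map_zero _).symm)
  simpa using congrArg Prod.snd h4

theorem tangentPart_fderiv {f : ℝ × ℝ → Space} {p : ℝ × ℝ}
    (hf : Function.Injective (fderiv ℝ f p)) (Z : ℝ × ℝ) :
    tangentPart f p (fderiv ℝ f p Z) = Z := by
  have hd := firstDet_ne_zero hf
  obtain ⟨x, y⟩ := Z
  have hZ : ((x, y) : ℝ × ℝ) = x • (1, 0) + y • (0, 1) := by simp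
  rw [hZ, map_add, map_smul, map_smul, ← hZ]
  simp only [tangentPart, firstDet, firstForm] at hd ⊢
  rw [Prod.mk.injEq, div_eq_iff hd, div_eq_iff hd]
  simp only [inner_add_left, inner_smul_left, conj_trivial,
    real_inner_comm (fderiv ℝ f p (1, 0)) (fderiv ℝ f p (0, 1))]
  constructor <;> ring

theorem tangentPart_smul_normal {f ν : ℝ × ℝ → Space} {Ω : Set (ℝ × ℝ)} (h : IsUnitNormal f ν Ω)
    {p : ℝ × ℝ} (hp : p ∈ Ω) (r : ℝ) : tangentPart f p (r • ν p) = 0 := by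
  have h1 : ∀ X, inner ℝ (ν p) (fderiv ℝ f p X) = 0 := fun X => by
    rw [real_inner_comm]; exact h.normal p hp X
  simp [tangentPart, inner_smul_left, h1]

/-! ### Unit normals and second fundamental forms -/

section Normal

variable {f ν : ℝ × ℝ → Space} {Ω : Set (ℝ × ℝ)} {p : ℝ × ℝ}

theorem IsUnitNormal.inner_self (h : IsUnitNormal f ν Ω) (hp : p ∈ Ω) :
    inner ℝ (ν p) (ν p) = (1 : ℝ) := by
  rw [real_inner_self_eq_norm_sq, h.unit p hp, one_pow]

theorem inner_along_along_normal (hf : ContDiffOn ℝ ∞ f Ω) (hΩ : IsOpen Ω)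
    (hn : ∀ p ∈ Ω, ∀ X : ℝ × ℝ, inner ℝ (fderiv ℝ f p X) (ν p) = 0)
    {Y : ℝ × ℝ → ℝ × ℝ} (hY : ContDiffOn ℝ ∞ Y Ω) (hp : p ∈ Ω) (X : ℝ × ℝ → ℝ × ℝ) :
    inner ℝ (along X (along Y f) p) (ν p) = secondForm f ν p (X p) (Y p) := by
  rw [along_along hf hY hΩ hp, inner_add_left, hn p hp, add_zero, secondForm]

theorem inner_along_normal (hf : ContDiffOn ℝ ∞ f Ω) (hΩ : IsOpen Ω) (h : IsUnitNormal f ν Ω)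
    {Y : ℝ × ℝ → ℝ × ℝ} (hY : ContDiffOn ℝ ∞ Y Ω) (hp : p ∈ Ω) (X : ℝ × ℝ → ℝ × ℝ) :
    inner ℝ (along X ν p) (along Y f p) = -secondForm f ν p (X p) (Y p) := by
  have h1 := along_inner (hf.along hY hΩ) h.smooth (fun q hq => h.normal q hq (Y q)) hΩ hp X
  rw [inner_along_along_normal hf hΩ h.normal hY hp, along_const, real_inner_comm] at h1
  linarith

theorem secondForm_symm (hf : ContDiffOn ℝ ∞ f Ω) (hΩ : IsOpen Ω) (hp : p ∈ Ω) (X Y : ℝ × ℝ) :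
    secondForm f ν p X Y = secondForm f ν p Y X := by
  rw [secondForm, secondForm, fderiv_fderiv_symm hf hΩ hp]

theorem secondForm_add_smul (p X Y u v : ℝ × ℝ) (a b c d : ℝ) :
    secondForm f ν p (a • X + b • Y) (c • u + d • v) =
      a * c * secondForm f ν p X u + a * d * secondForm f ν p X v +
      b * c * secondForm f ν p Y u + b * d * secondForm f ν p Y v := by
  simp only [secondForm, map_add, map_smul, add_apply,
    smul_apply, inner_add_left, inner_smul_left, conj_trivial, smul_add]
  ring

theorem firstForm_add_smul (p X Y u v : ℝ × ℝ) (a b c d : ℝ) :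
    firstForm f p (a • X + b • Y) (c • u + d • v) =
      a * c * firstForm f p X u + a * d * firstForm f p X v +
      b * c * firstForm f p Y u + b * d * firstForm f p Y v := by
  simp only [firstForm, map_add, map_smul, inner_add_left, inner_add_right, inner_smul_left,
    inner_smul_right, conj_trivial]
  ring

theorem firstForm_symm (p X Y : ℝ × ℝ) : firstForm f p X Y = firstForm f p Y X :=
  real_inner_comm _ _

end Normal

/-! ### Structure equations of the asymptotic net of a K-surface -/

/-- A K-surface together with a K-frame and its asymptotic angle `ω`. -/
structure IsAsymptoticNet (Ω : Set (ℝ × ℝ)) (ψ ν : ℝ × ℝ → Space) (E₁ E₃ : ℝ × ℝ → ℝ × ℝ)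
    (ω : ℝ × ℝ → ℝ) : Prop where
  kSurface : IsKSurface ψ ν Ω
  frame : IsKFrame ψ ν E₁ E₃ Ω
  angle : ∀ p ∈ Ω, ω p = frameAngle ψ E₁ E₃ p

namespace IsAsymptoticNet

variable {Ω : Set (ℝ × ℝ)} {ψ ν : ℝ × ℝ → Space} {E₁ E₃ : ℝ × ℝ → ℝ × ℝ} {ω : ℝ × ℝ → ℝ}
  {p : ℝ × ℝ}

theorem isOpen (h : IsAsymptoticNet Ω ψ ν E₁ E₃ ω) : IsOpen Ω :=
  h.kSurface.surface.rectangle.isOpen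

theorem smooth (h : IsAsymptoticNet Ω ψ ν E₁ E₃ ω) : ContDiffOn ℝ ∞ ψ Ω :=
  h.kSurface.surface.smooth

/-- The two families of asymptotic lines play symmetric roles. -/
theorem swap (h : IsAsymptoticNet Ω ψ ν E₁ E₃ ω) : IsAsymptoticNet Ω ψ ν E₃ E₁ ω where
  kSurface := h.kSurface
  frame :=
    { smooth_one := h.frame.smooth_three
      smooth_three := h.frame.smooth_one
      independent := fun p hp => LinearIndependent.pair_symm_iff.mp (h.frame.independent p hp)
      unit_one := h.frame.unit_three
      unit_three := h.frame.unit_one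
      asymptotic_one := h.frame.asymptotic_three
      asymptotic_three := h.frame.asymptotic_one
      side := fun p hp => by
        rw [secondForm_symm h.smooth h.isOpen hp]; exact h.frame.side p hp }
  angle := fun p hp => by
    rw [h.angle p hp, frameAngle, frameAngle, InnerProductGeometry.angle_comm]

theorem smooth_one (h : IsAsymptoticNet Ω ψ ν E₁ E₃ ω) : ContDiffOn ℝ ∞ (along E₁ ψ) Ω :=
  h.smooth.along h.frame.smooth_one h.isOpen

theorem smooth_three (h : IsAsymptoticNet Ω ψ ν E₁ E₃ ω) : ContDiffOn ℝ ∞ (along E₃ ψ) Ω :=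
  h.swap.smooth_one

theorem smooth_normal (h : IsAsymptoticNet Ω ψ ν E₁ E₃ ω) : ContDiffOn ℝ ∞ ν Ω :=
  h.kSurface.normal.smooth

theorem inner_one_one (h : IsAsymptoticNet Ω ψ ν E₁ E₃ ω) (hp : p ∈ Ω) :
    inner ℝ (along E₁ ψ p) (along E₁ ψ p) = (1 : ℝ) :=
  h.frame.unit_one p hp

theorem inner_three_three (h : IsAsymptoticNet Ω ψ ν E₁ E₃ ω) (hp : p ∈ Ω) :
    inner ℝ (along E₃ ψ p) (along E₃ ψ p) = (1 : ℝ) :=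
  h.frame.unit_three p hp

theorem norm_one (h : IsAsymptoticNet Ω ψ ν E₁ E₃ ω) (hp : p ∈ Ω) : ‖along E₁ ψ p‖ = 1 := by
  have := h.inner_one_one hp
  rw [real_inner_self_eq_norm_sq] at this
  exact (pow_eq_one_iff_of_nonneg (norm_nonneg _) two_ne_zero).mp this

theorem inner_one_three (h : IsAsymptoticNet Ω ψ ν E₁ E₃ ω) (hp : p ∈ Ω) :
    inner ℝ (along E₁ ψ p) (along E₃ ψ p) = Real.cos (ω p) := by
  rw [h.angle p hp, frameAngle, InnerProductGeometry.cos_angle]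
  change _ = _ / (‖along E₁ ψ p‖ * ‖along E₃ ψ p‖)
  rw [h.norm_one hp, h.swap.norm_one hp, mul_one, div_one]
  rfl

theorem inner_three_one (h : IsAsymptoticNet Ω ψ ν E₁ E₃ ω) (hp : p ∈ Ω) :
    inner ℝ (along E₃ ψ p) (along E₁ ψ p) = Real.cos (ω p) :=
  h.swap.inner_one_three hp

theorem inner_one_normal (h : IsAsymptoticNet Ω ψ ν E₁ E₃ ω) (hp : p ∈ Ω) :
    inner ℝ (along E₁ ψ p) (ν p) = 0 :=
  h.kSurface.normal.normal p hp _

theorem inner_three_normal (h : IsAsymptoticNet Ω ψ ν E₁ E₃ ω) (hp : p ∈ Ω) :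
    inner ℝ (along E₃ ψ p) (ν p) = 0 :=
  h.kSurface.normal.normal p hp _

/-- The equation `K = -1` in the asymptotic frame. -/
theorem secondForm_sq (h : IsAsymptoticNet Ω ψ ν E₁ E₃ ω) (hp : p ∈ Ω) :
    secondForm ψ ν p (E₁ p) (E₃ p) ^ 2 = 1 - Real.cos (ω p) ^ 2 := by
  obtain ⟨x, y, hX⟩ := exists_eq_smul_add_smul (h.frame.independent p hp) (1, 0)
  obtain ⟨z, w, hY⟩ := exists_eq_smul_add_smul (h.frame.independent p hp) (0, 1)
  have hK := h.kSurface.curvature p hp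
  have hd := firstDet_ne_zero (h.kSurface.surface.immersion p hp)
  rw [gaussCurvature, div_eq_iff hd] at hK
  have hC : firstForm ψ p (E₁ p) (E₃ p) = Real.cos (ω p) := h.inner_one_three hp
  simp only [firstDet, hX, hY, secondForm_add_smul, firstForm_add_smul,
    firstForm_symm p (E₃ p) (E₁ p), secondForm_symm h.smooth h.isOpen hp (E₃ p) (E₁ p), hC,
    h.frame.unit_one p hp, h.frame.unit_three p hp, h.frame.asymptotic_one p hp,
    h.frame.asymptotic_three p hp] at hK hd
  -- change of basis multiplies both determinants by the square of `x * w - y * z`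
  have hD : (x * w - y * z) ^ 2 ≠ 0 := by
    intro h0
    apply hd
    linear_combination (1 - Real.cos (ω p) ^ 2) * h0
  apply mul_left_cancel₀ hD
  linear_combination -hK

theorem sin_pos (h : IsAsymptoticNet Ω ψ ν E₁ E₃ ω) (hp : p ∈ Ω) : 0 < Real.sin (ω p) := by
  have h1 := h.secondForm_sq hp
  have h2 := h.frame.side p hp
  have h3 : 0 ≤ Real.sin (ω p) := by
    rw [h.angle p hp, frameAngle]
    exact InnerProductGeometry.sin_angle_nonneg _ _
  rw [← Real.sin_sq] at h1
  exact lt_of_le_of_ne h3 fun h0 => by rw [← h0] at h1; nlinarith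

theorem secondForm_one_three (h : IsAsymptoticNet Ω ψ ν E₁ E₃ ω) (hp : p ∈ Ω) :
    secondForm ψ ν p (E₁ p) (E₃ p) = Real.sin (ω p) := by
  have h1 := h.secondForm_sq hp
  rw [← Real.sin_sq] at h1
  exact (pow_left_inj₀ (h.frame.side p hp).le (h.sin_pos hp).le two_ne_zero).mp h1

theorem cos_sq_lt_one (h : IsAsymptoticNet Ω ψ ν E₁ E₃ ω) (hp : p ∈ Ω) :
    Real.cos (ω p) ^ 2 < 1 := by
  rw [Real.cos_sq']
  linarith [pow_pos (h.sin_pos hp) 2]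

theorem angle_mem_Ioo (h : IsAsymptoticNet Ω ψ ν E₁ E₃ ω) (hp : p ∈ Ω) :
    0 < ω p ∧ ω p < Real.pi := by
  have h1 := h.sin_pos hp
  have h2 : 0 ≤ ω p := by rw [h.angle p hp]; exact InnerProductGeometry.angle_nonneg _ _
  have h3 : ω p ≤ Real.pi := by rw [h.angle p hp]; exact InnerProductGeometry.angle_le_pi _ _
  refine ⟨lt_of_le_of_ne h2 fun h0 => ?_, lt_of_le_of_ne h3 fun h0 => ?_⟩
  · rw [← h0, Real.sin_zero] at h1
    exact lt_irrefl _ h1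
  · rw [h0, Real.sin_pi] at h1
    exact lt_irrefl _ h1

theorem smooth_angle (h : IsAsymptoticNet Ω ψ ν E₁ E₃ ω) : ContDiffOn ℝ ∞ ω Ω := by
  have h1 : ContDiffOn ℝ ∞ (fun q => Real.arccos (inner ℝ (along E₁ ψ q) (along E₃ ψ q))) Ω := by
    intro q hq
    have h2 := h.cos_sq_lt_one hq
    refine ContDiffAt.comp_contDiffWithinAt (g := Real.arccos) q (Real.contDiffAt_arccos ?_ ?_)
      (h.smooth_one.inner ℝ h.smooth_three q hq) <;> rw [h.inner_one_three hq] <;> intro h0 <;>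
      rw [h0] at h2 <;> norm_num at h2
  refine h1.congr fun q hq => ?_
  rw [h.inner_one_three hq, Real.arccos_cos (h.angle_mem_Ioo hq).1.le (h.angle_mem_Ioo hq).2.le]

/-- Vectors are determined by their scalar products with `dψ (E₁)`, `dψ (E₃)` and `ν`. -/
theorem ext (h : IsAsymptoticNet Ω ψ ν E₁ E₃ ω) (hp : p ∈ Ω) {v w : Space}
    (h1 : inner ℝ v (along E₁ ψ p) = inner ℝ w (along E₁ ψ p))
    (h3 : inner ℝ v (along E₃ ψ p) = inner ℝ w (along E₃ ψ p))
    (hn : inner ℝ v (ν p) = inner ℝ w (ν p)) : v = w :=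
  eq_of_inner_frame (h.inner_one_one hp) (h.inner_three_three hp)
    (h.kSurface.normal.inner_self hp) (h.inner_one_three hp) (h.inner_one_normal hp)
    (h.inner_three_normal hp) (h.cos_sq_lt_one hp) h1 h3 hn

theorem inner_along_normal_one (h : IsAsymptoticNet Ω ψ ν E₁ E₃ ω) (hp : p ∈ Ω) :
    inner ℝ (along E₁ ν p) (along E₁ ψ p) = 0 := by
  rw [inner_along_normal h.smooth h.isOpen h.kSurface.normal h.frame.smooth_one hp,
    h.frame.asymptotic_one p hp, neg_zero]

theorem inner_along_normal_three (h : IsAsymptoticNet Ω ψ ν E₁ E₃ ω) (hp : p ∈ Ω) :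
    inner ℝ (along E₁ ν p) (along E₃ ψ p) = -Real.sin (ω p) := by
  rw [inner_along_normal h.smooth h.isOpen h.kSurface.normal h.frame.smooth_three hp,
    h.secondForm_one_three hp]

theorem inner_along_one_one (h : IsAsymptoticNet Ω ψ ν E₁ E₃ ω) (hp : p ∈ Ω)
    (X : ℝ × ℝ → ℝ × ℝ) : inner ℝ (along X (along E₁ ψ) p) (along E₁ ψ p) = 0 :=
  inner_along_self h.smooth_one (fun _ hq => h.inner_one_one hq) h.isOpen hp X

theorem inner_along_one_three (h : IsAsymptoticNet Ω ψ ν E₁ E₃ ω) (hp : p ∈ Ω)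
    (X : ℝ × ℝ → ℝ × ℝ) :
    inner ℝ (along X (along E₁ ψ) p) (along E₃ ψ p) +
      inner ℝ (along X (along E₃ ψ) p) (along E₁ ψ p) = -(Real.sin (ω p) * along X ω p) := by
  rw [← along_cos h.smooth_angle h.isOpen hp, ← along_inner h.smooth_one h.smooth_three
    (fun q hq => h.inner_one_three hq) h.isOpen hp, real_inner_comm (along E₁ ψ p)]

/-- Weingarten equation along an asymptotic direction. -/
theorem along_normal (h : IsAsymptoticNet Ω ψ ν E₁ E₃ ω) (hp : p ∈ Ω) :
    along E₁ ν p =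
      (-(Real.sin (ω p))⁻¹) • (along E₃ ψ p - Real.cos (ω p) • along E₁ ψ p) := by
  have hs := (h.sin_pos hp).ne'
  apply h.ext hp
  · rw [h.inner_along_normal_one hp, inner_smul_left, inner_sub_left, inner_smul_left,
      h.inner_three_one hp, h.inner_one_one hp]
    simp
  · rw [h.inner_along_normal_three hp, inner_smul_left, inner_sub_left, inner_smul_left,
      h.inner_three_three hp, h.inner_one_three hp]
    simp only [conj_trivial]
    field_simp
    linear_combination -Real.sin_sq_add_cos_sq (ω p)
  · rw [inner_along_self h.smooth_normal (fun _ hq => h.kSurface.normal.inner_self hq) h.isOpen hp,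
      inner_smul_left, inner_sub_left, inner_smul_left, h.inner_three_normal hp,
      h.inner_one_normal hp]
    simp

/-- A relation between the components of `[E₁, E₃]`, from the mixed derivatives of `ψ` and of `ν`
paired with `dψ (E₁)`. With the interchanged relation it forces the bracket to vanish. -/
theorem bracket_coeff (h : IsAsymptoticNet Ω ψ ν E₁ E₃ ω) (hp : p ∈ Ω) {x y : ℝ}
    (hB : bracket E₁ E₃ p = x • E₁ p + y • E₃ p) : Real.cos (ω p) * x + y = 0 := by
  have hs := (h.sin_pos hp).ne'
  have hψ := fderiv_bracket h.smooth h.frame.smooth_one h.frame.smooth_three h.isOpen hp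
  have hν := fderiv_bracket h.smooth_normal h.frame.smooth_one h.frame.smooth_three h.isOpen hp
  rw [hB, map_add, map_smul, map_smul] at hψ hν
  change x • along E₁ ψ p + y • along E₃ ψ p = _ at hψ
  change x • along E₁ ν p + y • along E₃ ν p = _ at hν
  have hψ1 := congrArg (fun v => inner ℝ v (along E₁ ψ p)) hψ
  have hψ3 := congrArg (fun v => inner ℝ v (along E₃ ψ p)) hψ
  have hν1 := congrArg (fun v => inner ℝ v (along E₁ ψ p)) hν
  simp only [inner_add_left, inner_sub_left, inner_smul_left, conj_trivial, h.inner_one_one hp,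
    h.inner_one_three hp, h.inner_three_one hp, h.inner_three_three hp,
    h.inner_along_normal_one hp, h.swap.inner_along_normal_three hp, h.inner_along_one_one hp,
    h.swap.inner_along_one_one hp] at hψ1 hψ3 hν1
  have h1 := along_inner (h.smooth_normal.along h.frame.smooth_three h.isOpen) h.smooth_one
    (fun q hq => h.swap.inner_along_normal_three hq) h.isOpen hp E₁
  have h2 := along_inner (h.smooth_normal.along h.frame.smooth_one h.isOpen) h.smooth_one
    (fun q hq => h.inner_along_normal_one hq) h.isOpen hp E₃
  rw [along_const, h.along_normal hp, inner_smul_left, inner_sub_left, inner_smul_left,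
    real_inner_comm (along E₃ (along E₁ ψ) p), real_inner_comm (along E₃ (along E₁ ψ) p),
    h.inner_along_one_one hp] at h2
  rw [along_neg, along_sin h.smooth_angle h.isOpen hp, h.swap.along_normal hp, inner_smul_left,
    inner_sub_left, inner_smul_left, real_inner_comm (along E₁ (along E₁ ψ) p),
    real_inner_comm (along E₁ (along E₁ ψ) p), h.inner_along_one_one hp] at h1
  have h3 := h.inner_along_one_three hp E₁
  simp only [conj_trivial] at h1 h2
  have hsc := Real.sin_sq_add_cos_sq (ω p)
  field_simp at h1 h2
  linear_combination (1 / 2) * (Real.cos (ω p) * hψ1 + hψ3 + Real.cos (ω p) * h3 - h1 + h2 -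
    Real.sin (ω p) * hν1 - y * hsc)

/-- The asymptotic lines of a K-surface form a Chebyshev net: unit asymptotic fields commute. -/
theorem bracket_eq_zero (h : IsAsymptoticNet Ω ψ ν E₁ E₃ ω) (hp : p ∈ Ω) :
    bracket E₁ E₃ p = 0 := by
  obtain ⟨x, y, hB⟩ := exists_eq_smul_add_smul (h.frame.independent p hp) (bracket E₁ E₃ p)
  have hB' : bracket E₃ E₁ p = (-y) • E₃ p + (-x) • E₁ p := by
    rw [bracket_swap, hB]
    module
  have h1 := h.bracket_coeff hp hB
  have h2 := h.swap.bracket_coeff hp hB'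
  have hC : 1 - Real.cos (ω p) ^ 2 ≠ 0 := by linarith [h.cos_sq_lt_one hp]
  have hx : x = 0 := by
    apply mul_left_cancel₀ hC
    linear_combination -h2 - Real.cos (ω p) * h1
  have hy : y = 0 := by
    apply mul_left_cancel₀ hC
    linear_combination h1 + Real.cos (ω p) * h2
  rw [hB, hx, hy, zero_smul, zero_smul, add_zero]

/-- Derivatives along the two asymptotic fields commute. -/
theorem along_comm {V : Type*} [NormedAddCommGroup V] [NormedSpace ℝ V]
    (h : IsAsymptoticNet Ω ψ ν E₁ E₃ ω) {F : ℝ × ℝ → V} (hF : ContDiffOn ℝ ∞ F Ω)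
    (hp : p ∈ Ω) : along E₁ (along E₃ F) p = along E₃ (along E₁ F) p := by
  have := fderiv_bracket hF h.frame.smooth_one h.frame.smooth_three h.isOpen hp
  rwa [h.bracket_eq_zero hp, map_zero, eq_comm, sub_eq_zero] at this

/-- The field `dψ (E₃)` is parallel along `E₁`: its derivative `E₁ (dψ (E₃))` is normal. -/
theorem along_one_three (h : IsAsymptoticNet Ω ψ ν E₁ E₃ ω) (hp : p ∈ Ω) :
    along E₁ (along E₃ ψ) p = Real.sin (ω p) • ν p := by
  apply h.ext hp
  · rw [h.along_comm h.smooth hp, h.inner_along_one_one hp, inner_smul_left, real_inner_comm,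
      h.inner_one_normal hp, mul_zero]
  · rw [h.swap.inner_along_one_one hp, inner_smul_left, real_inner_comm,
      h.inner_three_normal hp, mul_zero]
  · rw [inner_along_along_normal h.smooth h.isOpen h.kSurface.normal.normal h.frame.smooth_three hp,
      h.secondForm_one_three hp, inner_smul_left, h.kSurface.normal.inner_self hp, mul_one,
      conj_trivial]

theorem inner_along_one_one_three (h : IsAsymptoticNet Ω ψ ν E₁ E₃ ω) (hp : p ∈ Ω) :
    inner ℝ (along E₁ (along E₁ ψ) p) (along E₃ ψ p) = -(Real.sin (ω p) * along E₁ ω p) := by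
  rw [← h.inner_along_one_three hp, h.along_one_three hp, inner_smul_left,
    real_inner_comm (along E₁ ψ p), h.inner_one_normal hp, mul_zero, add_zero]

theorem along_one_one (h : IsAsymptoticNet Ω ψ ν E₁ E₃ ω) (hp : p ∈ Ω) :
    along E₁ (along E₁ ψ) p = (-(along E₁ ω p / Real.sin (ω p))) •
      (along E₃ ψ p - Real.cos (ω p) • along E₁ ψ p) := by
  have hs := (h.sin_pos hp).ne'
  apply h.ext hp
  · rw [h.inner_along_one_one hp, inner_smul_left, inner_sub_left, inner_smul_left,
      h.inner_three_one hp, h.inner_one_one hp]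
    simp
  · rw [h.inner_along_one_one_three hp, inner_smul_left, inner_sub_left, inner_smul_left,
      h.inner_three_three hp, h.inner_one_three hp]
    simp only [conj_trivial]
    field_simp
    linear_combination -along E₁ ω p * Real.sin_sq_add_cos_sq (ω p)
  · rw [inner_along_along_normal h.smooth h.isOpen h.kSurface.normal.normal h.frame.smooth_one hp,
      h.frame.asymptotic_one p hp, inner_smul_left, inner_sub_left, inner_smul_left,
      h.inner_three_normal hp, h.inner_one_normal hp]
    simp

/-- The Gauss equation of the K-surface, obtained by differentiating `dψ (E₁)` in both orders. -/
theorem sine_gordon (h : IsAsymptoticNet Ω ψ ν E₁ E₃ ω) (hp : p ∈ Ω) :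
    along E₃ (along E₁ ω) p = Real.sin (ω p) := by
  have hs := (h.sin_pos hp).ne'
  have h31 : ∀ q ∈ Ω, inner ℝ (along E₃ (along E₁ ψ) q) (along E₃ ψ q) = (0 : ℝ) := fun q hq => by
    rw [h.swap.along_one_three hq, inner_smul_left, real_inner_comm, h.inner_three_normal hq,
      mul_zero]
  have h1 := along_inner (h.smooth_one.along h.frame.smooth_three h.isOpen) h.smooth_three h31
    h.isOpen hp E₁
  have h2 := along_inner (h.smooth_one.along h.frame.smooth_one h.isOpen) h.smooth_three
    (fun q hq => h.inner_along_one_one_three hq) h.isOpen hp E₃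
  rw [along_const, h.along_comm h.smooth_one hp, h.swap.along_one_three hp, h.along_one_three hp,
    inner_smul_left, inner_smul_right, h.kSurface.normal.inner_self hp] at h1
  have hsin : ContDiffOn ℝ ∞ (fun q => Real.sin (ω q)) Ω :=
    Real.contDiff_sin.comp_contDiffOn h.smooth_angle
  rw [along_neg, along_mul hsin (h.smooth_angle.along h.frame.smooth_one h.isOpen) h.isOpen hp,
    along_sin h.smooth_angle h.isOpen hp, h.along_one_one hp, h.swap.along_one_one hp] at h2
  simp only [inner_smul_left, inner_smul_right, inner_sub_left, inner_sub_right,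
    h.inner_three_one hp, h.inner_one_three hp, h.inner_one_one hp, h.inner_three_three hp,
    conj_trivial] at h1 h2
  field_simp at h2
  apply mul_left_cancel₀ (pow_ne_zero 3 hs)
  linear_combination h2 - Real.sin (ω p) ^ 2 * h1 -
    along E₃ ω p * along E₁ ω p * Real.cos (ω p) * Real.sin_sq_add_cos_sq (ω p)

end IsAsymptoticNet

/-! ### Orientation of the asymptotic frame -/

namespace IsAsymptoticNet

variable {Ω : Set (ℝ × ℝ)} {ψ ν : ℝ × ℝ → Space} {E₁ E₃ : ℝ × ℝ → ℝ × ℝ} {ω : ℝ × ℝ → ℝ}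
  {p : ℝ × ℝ}

theorem cross_eq_smul_normal (h : IsAsymptoticNet Ω ψ ν E₁ E₃ ω) (hp : p ∈ Ω) :
    cross (along E₃ ψ p) (along E₁ ψ p) =
      (inner ℝ (cross (along E₃ ψ p) (along E₁ ψ p)) (ν p) : ℝ) • ν p := by
  apply h.ext hp
  · rw [inner_cross_self_right, inner_smul_left, real_inner_comm (along E₁ ψ p),
      h.inner_one_normal hp, mul_zero]
  · rw [inner_cross_self_left, inner_smul_left, real_inner_comm (along E₃ ψ p),
      h.inner_three_normal hp, mul_zero]
  · rw [inner_smul_left, h.kSurface.normal.inner_self hp, mul_one, conj_trivial]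

theorem triple_sq (h : IsAsymptoticNet Ω ψ ν E₁ E₃ ω) (hp : p ∈ Ω) :
    (inner ℝ (cross (along E₃ ψ p) (along E₁ ψ p)) (ν p) : ℝ) ^ 2 = Real.sin (ω p) ^ 2 := by
  have h1 := inner_cross_cross (along E₃ ψ p) (along E₁ ψ p) (along E₃ ψ p) (along E₁ ψ p)
  rw [h.inner_one_one hp, h.inner_three_three hp, h.inner_one_three hp, h.inner_three_one hp,
    h.cross_eq_smul_normal hp, inner_smul_left, inner_smul_right,
    h.kSurface.normal.inner_self hp, conj_trivial] at h1
  linear_combination h1 - Real.sin_sq_add_cos_sq (ω p)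

theorem triple_ne_zero (h : IsAsymptoticNet Ω ψ ν E₁ E₃ ω) (hp : p ∈ Ω) :
    (inner ℝ (cross (along E₃ ψ p) (along E₁ ψ p)) (ν p) : ℝ) ≠ 0 := by
  intro h0
  have h1 := h.triple_sq hp
  rw [h0] at h1
  exact (pow_pos (h.sin_pos hp) 2).ne' (by simpa using h1.symm)

/-- The triple product of `(dψ (E₃), dψ (E₁), ν)` is `± sin ω`, with the same sign everywhere
because a rectangle is connected. -/
theorem exists_orientation (h : IsAsymptoticNet Ω ψ ν E₁ E₃ ω) :
    ∃ ε : ℝ, (ε = 1 ∨ ε = -1) ∧ ∀ p ∈ Ω,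
      inner ℝ (cross (along E₃ ψ p) (along E₁ ψ p)) (ν p) = ε * Real.sin (ω p) := by
  have hd : ContinuousOn
      (fun p => (inner ℝ (cross (along E₃ ψ p) (along E₁ ψ p)) (ν p) : ℝ)) Ω :=
    ((((crossL.contDiff (n := ∞)).comp_contDiffOn h.smooth_three).clm_apply h.smooth_one).inner ℝ
      h.smooth_normal).continuousOn
  have hs : ContinuousOn (fun p => Real.sin (ω p)) Ω :=
    Real.continuous_sin.comp_continuousOn h.smooth_angle.continuousOn
  rcases h.kSurface.surface.rectangle.isPreconnected.eq_or_eq_neg_of_sq_eq hd hs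
    (fun p hp => h.triple_sq hp) (fun hp => (h.sin_pos hp).ne') with h1 | h1
  · exact ⟨1, Or.inl rfl, fun p hp => by rw [one_mul]; exact h1 hp⟩
  · exact ⟨-1, Or.inr rfl, fun p hp => by rw [neg_one_mul]; exact h1 hp⟩

end IsAsymptoticNet

/-! ### Rotation fields -/

/-- Equality of mixed second derivatives of the infinitesimal isometry `ξ`, for `dξ = η × dψ`. -/
theorem IsRotationField.cross_comm {Ω : Set (ℝ × ℝ)} {ψ η : ℝ × ℝ → Space}
    (hR : IsRotationField ψ η Ω) (hψ : ContDiffOn ℝ ∞ ψ Ω) (hΩ : IsOpen Ω) {p : ℝ × ℝ}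
    (hp : p ∈ Ω) (X Y : ℝ × ℝ) :
    cross (fderiv ℝ η p X) (fderiv ℝ ψ p Y) = cross (fderiv ℝ η p Y) (fderiv ℝ ψ p X) := by
  obtain ⟨hη, ξ, ζ, hξ, -, hdξ⟩ := hR
  have key : ∀ u v : ℝ × ℝ, fderiv ℝ (fderiv ℝ ξ) p u v =
      cross (η p) (fderiv ℝ (fderiv ℝ ψ) p u v) + cross (fderiv ℝ η p u) (fderiv ℝ ψ p v) := by
    intro u v
    have h0 : ∀ {F : ℝ × ℝ → Space}, ContDiffOn ℝ ∞ F Ω →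
        fderiv ℝ (fderiv ℝ F) p u v = along (fun _ => u) (along (fun _ => v) F) p := by
      intro F hF
      rw [along_along hF contDiffOn_const hΩ hp]
      simp
    have h1 : ∀ q ∈ Ω, along (fun _ => v) ξ q = crossL (η q) (along (fun _ => v) ψ q) :=
      fun q hq => ((hdξ q hq).2 v).1
    rw [h0 hξ.smooth, h0 hψ, along_congr h1 hΩ hp, along,
      crossL.fderiv_of_bilinear (hη.differentiableAt_of_isOpen hΩ hp)
        ((hψ.along contDiffOn_const hΩ).differentiableAt_of_isOpen hΩ hp)]
    rfl
  have h2 := fderiv_fderiv_symm hξ.smooth hΩ hp X Y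
  rw [key, key, fderiv_fderiv_symm hψ hΩ hp X Y] at h2
  exact add_left_cancel h2

/-- An asymptotic net of a K-surface together with an immersed rotation field `η`. -/
structure IsRotatedNet (Ω : Set (ℝ × ℝ)) (ψ ν η : ℝ × ℝ → Space) (E₁ E₃ : ℝ × ℝ → ℝ × ℝ)
    (ω : ℝ × ℝ → ℝ) : Prop extends IsAsymptoticNet Ω ψ ν E₁ E₃ ω where
  vSurface : IsSurfaceElement η Ω
  rotation : IsRotationField ψ η Ω

/-- The coefficient `c = ⟨dη (E₁), dψ (E₃)⟩`; interchanging the two fields gives `b`. -/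
noncomputable def rotationCoeff (ψ η : ℝ × ℝ → Space) (E₁ E₃ : ℝ × ℝ → ℝ × ℝ) (p : ℝ × ℝ) : ℝ :=
  inner ℝ (along E₁ η p) (along E₃ ψ p)

namespace IsRotatedNet

variable {Ω : Set (ℝ × ℝ)} {ψ ν η : ℝ × ℝ → Space} {E₁ E₃ : ℝ × ℝ → ℝ × ℝ} {ω : ℝ × ℝ → ℝ}
  {p : ℝ × ℝ}

theorem swap (h : IsRotatedNet Ω ψ ν η E₁ E₃ ω) : IsRotatedNet Ω ψ ν η E₃ E₁ ω where
  toIsAsymptoticNet := h.toIsAsymptoticNet.swap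
  vSurface := h.vSurface
  rotation := h.rotation

theorem smooth_rotationCoeff (h : IsRotatedNet Ω ψ ν η E₁ E₃ ω) :
    ContDiffOn ℝ ∞ (rotationCoeff ψ η E₁ E₃) Ω :=
  (h.vSurface.smooth.along h.frame.smooth_one h.isOpen).inner ℝ h.smooth_three

theorem cross_comm (h : IsRotatedNet Ω ψ ν η E₁ E₃ ω) (hp : p ∈ Ω) :
    cross (along E₁ η p) (along E₃ ψ p) = cross (along E₃ η p) (along E₁ ψ p) :=
  h.rotation.cross_comm h.smooth h.isOpen hp _ _

/-- The derivative of `η` is tangential: pairing `cross_comm` with `dψ (E₁)` leaves the triple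
product of `dη (E₁)` with the tangent frame. -/
theorem inner_along_one_normal (h : IsRotatedNet Ω ψ ν η E₁ E₃ ω) (hp : p ∈ Ω) :
    inner ℝ (along E₁ η p) (ν p) = 0 := by
  have h1 := congrArg (fun v => inner ℝ v (along E₁ ψ p)) (h.cross_comm hp)
  simp only [inner_cross_self_right] at h1
  rw [inner_cross_rotate, h.cross_eq_smul_normal hp, inner_smul_left, conj_trivial,
    real_inner_comm (along E₁ η p) (ν p)] at h1
  exact (mul_eq_zero.mp h1).resolve_left (h.triple_ne_zero hp)

theorem isUnitNormal (h : IsRotatedNet Ω ψ ν η E₁ E₃ ω) : IsUnitNormal η ν Ω where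
  smooth := h.smooth_normal
  unit := h.kSurface.normal.unit
  normal := fun p hp X => by
    obtain ⟨x, y, rfl⟩ := exists_eq_smul_add_smul (h.frame.independent p hp) X
    have h1 := h.inner_along_one_normal hp
    have h3 := h.swap.inner_along_one_normal hp
    simp only [along] at h1 h3
    rw [map_add, map_smul, map_smul, inner_add_left, inner_smul_left, inner_smul_left, h1, h3,
      mul_zero, mul_zero, add_zero]

/-- Symmetry of the second fundamental form of `η`, written with the Weingarten equations: the two
diagonal entries of the rotation operator agree. -/
theorem inner_sub_eq (h : IsRotatedNet Ω ψ ν η E₁ E₃ ω) (hp : p ∈ Ω) :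
    inner ℝ (along E₁ η p) (along E₁ ψ p) - Real.cos (ω p) * inner ℝ (along E₁ η p) (along E₃ ψ p) =
    inner ℝ (along E₃ η p) (along E₃ ψ p) -
      Real.cos (ω p) * inner ℝ (along E₃ η p) (along E₁ ψ p) := by
  have h1 := secondForm_symm (ν := ν) h.vSurface.smooth h.isOpen hp (E₁ p) (E₃ p)
  rw [← neg_inj, ← inner_along_normal h.vSurface.smooth h.isOpen h.isUnitNormal
    h.frame.smooth_three hp, ← inner_along_normal h.vSurface.smooth h.isOpen h.isUnitNormal
    h.frame.smooth_one hp, h.along_normal hp, h.swap.along_normal hp] at h1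
  simp only [inner_smul_left, inner_sub_left, conj_trivial] at h1
  have h2 := mul_left_cancel₀ (neg_ne_zero.mpr (inv_ne_zero (h.sin_pos hp).ne')) h1
  rw [real_inner_comm, real_inner_comm (along E₃ η p) (along E₁ ψ p),
    real_inner_comm (along E₁ η p) (along E₁ ψ p),
    real_inner_comm (along E₁ η p) (along E₃ ψ p)] at h2
  exact h2.symm

/-- The tangent vector `dη (E₁)` expanded in the frame of `ψ`. -/
theorem sin_sq_smul_along (h : IsRotatedNet Ω ψ ν η E₁ E₃ ω) (hp : p ∈ Ω) :
    Real.sin (ω p) ^ 2 • along E₁ η p =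
      (inner ℝ (along E₁ η p) (along E₁ ψ p) -
        Real.cos (ω p) * inner ℝ (along E₁ η p) (along E₃ ψ p) : ℝ) • along E₁ ψ p +
      (inner ℝ (along E₁ η p) (along E₃ ψ p) -
        Real.cos (ω p) * inner ℝ (along E₁ η p) (along E₁ ψ p) : ℝ) • along E₃ ψ p := by
  apply h.ext hp <;> simp only [inner_add_left, inner_smul_left, conj_trivial, h.inner_one_one hp,
    h.inner_one_three hp, h.inner_three_one hp, h.inner_three_three hp, h.inner_one_normal hp,
    h.inner_three_normal hp, h.inner_along_one_normal hp, Real.sin_sq] <;> ring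

/-- The diagonal entry of the rotation operator at `E₁` vanishes: `cross_comm` makes the diagonal
entries opposite, and `inner_sub_eq` makes them equal. -/
theorem inner_along_one_one_eq (h : IsRotatedNet Ω ψ ν η E₁ E₃ ω) (hp : p ∈ Ω) :
    inner ℝ (along E₁ η p) (along E₁ ψ p) =
      Real.cos (ω p) * inner ℝ (along E₁ η p) (along E₃ ψ p) := by
  have h1 := h.inner_sub_eq hp
  -- the normal component of `cross_comm`; the factor `sin² ω` clears denominators in the frame
  have h2 := congrArg (fun v => Real.sin (ω p) ^ 2 * inner ℝ v (ν p)) (h.cross_comm hp)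
  have aux : ∀ v w : Space, Real.sin (ω p) ^ 2 * inner ℝ (cross v w) (ν p) =
      inner ℝ (cross (Real.sin (ω p) ^ 2 • v) w) (ν p) := fun v w => by
    rw [cross_smul_left, inner_smul_left, conj_trivial]
  have self : ∀ v : Space, cross v v = 0 := fun v => by simp [cross]
  simp only [aux] at h2
  rw [h.sin_sq_smul_along hp, h.swap.sin_sq_smul_along hp] at h2
  simp only [cross_add_left, cross_smul_left, self, inner_smul_left,
    conj_trivial, smul_zero, add_zero, ← h1] at h2
  rw [inner_cross_swap] at h2
  have h3 := h.triple_ne_zero hp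
  rw [← sub_eq_zero]
  apply mul_left_cancel₀ h3
  linear_combination (-1 / 2) * h2

/-- The first column of the rotation operator. -/
theorem along_one_eq (h : IsRotatedNet Ω ψ ν η E₁ E₃ ω) (hp : p ∈ Ω) :
    along E₁ η p = rotationCoeff ψ η E₁ E₃ p • along E₃ ψ p := by
  apply h.ext hp
  · rw [h.inner_along_one_one_eq hp, inner_smul_left, h.inner_three_one hp, mul_comm]
    rfl
  · rw [inner_smul_left, h.inner_three_three hp, mul_one]
    rfl
  · rw [h.inner_along_one_normal hp, inner_smul_left, h.inner_three_normal hp, mul_zero]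

theorem rotationCoeff_ne_zero (h : IsRotatedNet Ω ψ ν η E₁ E₃ ω) (hp : p ∈ Ω) :
    rotationCoeff ψ η E₁ E₃ p ≠ 0 := by
  intro h0
  have h1 := h.along_one_eq hp
  rw [h0, zero_smul, along] at h1
  exact (h.frame.independent p hp).ne_zero 0
    (h.vSurface.immersion p hp (h1.trans (map_zero _).symm))

theorem fderiv_eq (h : IsRotatedNet Ω ψ ν η E₁ E₃ ω) (hp : p ∈ Ω) (x y : ℝ) :
    fderiv ℝ η p (x • E₁ p + y • E₃ p) = fderiv ℝ ψ p
      ((rotationCoeff ψ η E₃ E₁ p * y) • E₁ p + (rotationCoeff ψ η E₁ E₃ p * x) • E₃ p) := by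
  have h1 := h.along_one_eq hp
  have h3 := h.swap.along_one_eq hp
  simp only [along] at h1 h3
  simp only [map_add, map_smul, h1, h3]
  module

theorem firstForm_eq (h : IsRotatedNet Ω ψ ν η E₁ E₃ ω) (hp : p ∈ Ω) (x y z w : ℝ) :
    firstForm η p (x • E₁ p + y • E₃ p) (z • E₁ p + w • E₃ p) =
      rotationCoeff ψ η E₁ E₃ p ^ 2 * (x * z) +
      rotationCoeff ψ η E₃ E₁ p * rotationCoeff ψ η E₁ E₃ p * Real.cos (ω p) * (x * w + y * z) +
      rotationCoeff ψ η E₃ E₁ p ^ 2 * (y * w) := by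
  have hC : firstForm ψ p (E₁ p) (E₃ p) = Real.cos (ω p) := h.inner_one_three hp
  rw [firstForm, h.fderiv_eq hp, h.fderiv_eq hp, ← firstForm, firstForm_add_smul,
    firstForm_symm p (E₃ p) (E₁ p), hC, h.frame.unit_one p hp, h.frame.unit_three p hp]
  ring

theorem secondForm_one_one (h : IsRotatedNet Ω ψ ν η E₁ E₃ ω) (hp : p ∈ Ω) :
    secondForm η ν p (E₁ p) (E₁ p) = rotationCoeff ψ η E₁ E₃ p * Real.sin (ω p) := by
  rw [← neg_inj, ← inner_along_normal h.vSurface.smooth h.isOpen h.isUnitNormal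
    h.frame.smooth_one hp, h.along_one_eq hp, inner_smul_right, h.inner_along_normal_three hp,
    mul_neg]

/-- The V-net is conjugate. -/
theorem secondForm_one_three_eq_zero (h : IsRotatedNet Ω ψ ν η E₁ E₃ ω) (hp : p ∈ Ω) :
    secondForm η ν p (E₁ p) (E₃ p) = 0 := by
  rw [← neg_inj, ← inner_along_normal h.vSurface.smooth h.isOpen h.isUnitNormal
    h.frame.smooth_three hp, h.swap.along_one_eq hp, inner_smul_right,
    h.inner_along_normal_one hp, mul_zero, neg_zero]

theorem secondForm_eq (h : IsRotatedNet Ω ψ ν η E₁ E₃ ω) (hp : p ∈ Ω) (x y z w : ℝ) :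
    secondForm η ν p (x • E₁ p + y • E₃ p) (z • E₁ p + w • E₃ p) = Real.sin (ω p) *
      (rotationCoeff ψ η E₁ E₃ p * (x * z) + rotationCoeff ψ η E₃ E₁ p * (y * w)) := by
  rw [secondForm_add_smul, h.secondForm_one_one hp, h.swap.secondForm_one_one hp,
    h.secondForm_one_three_eq_zero hp, h.swap.secondForm_one_three_eq_zero hp]
  ring

theorem curvatures (h : IsRotatedNet Ω ψ ν η E₁ E₃ ω) (hp : p ∈ Ω) :
    meanCurvature η ν p = (rotationCoeff ψ η E₃ E₁ p + rotationCoeff ψ η E₁ E₃ p) /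
      (2 * (rotationCoeff ψ η E₃ E₁ p * rotationCoeff ψ η E₁ E₃ p) * Real.sin (ω p)) ∧
    gaussCurvature η ν p = 1 / (rotationCoeff ψ η E₃ E₁ p * rotationCoeff ψ η E₁ E₃ p) := by
  obtain ⟨x, y, hX⟩ := exists_eq_smul_add_smul (h.frame.independent p hp) (1, 0)
  obtain ⟨z, w, hY⟩ := exists_eq_smul_add_smul (h.frame.independent p hp) (0, 1)
  have hd := firstDet_ne_zero (h.vSurface.immersion p hp)
  have hb := h.swap.rotationCoeff_ne_zero hp
  have hc := h.rotationCoeff_ne_zero hp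
  have hs := (h.sin_pos hp).ne'
  have hdet : firstDet η p = (rotationCoeff ψ η E₃ E₁ p * rotationCoeff ψ η E₁ E₃ p *
      Real.sin (ω p) * (x * w - y * z)) ^ 2 := by
    simp only [firstDet, hX, hY, h.firstForm_eq hp]
    rw [mul_pow, mul_pow, Real.sin_sq]
    ring
  rw [hdet] at hd
  have hD : x * w - y * z ≠ 0 := fun h0 => hd (by rw [h0]; ring)
  constructor
  · rw [meanCurvature, hdet]
    simp only [hX, hY, h.firstForm_eq hp, h.secondForm_eq hp]
    field_simp
    ring
  · rw [gaussCurvature, hdet]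
    simp only [hX, hY, h.secondForm_eq hp]
    field_simp
    ring

/-- The Codazzi equation, obtained from `E₁ (dη (E₃)) = E₃ (dη (E₁))`. -/
theorem codazzi (h : IsRotatedNet Ω ψ ν η E₁ E₃ ω) (hp : p ∈ Ω) :
    -along E₁ (rotationCoeff ψ η E₃ E₁) p =
      rotationCoeff ψ η E₁ E₃ p * (1 / Real.sin (ω p)) * along E₃ ω p +
      rotationCoeff ψ η E₃ E₁ p * (Real.cos (ω p) / Real.sin (ω p)) * along E₁ ω p := by
  have hs := (h.sin_pos hp).ne'
  have h1 := h.along_comm h.vSurface.smooth hp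
  rw [along_congr (fun q hq => h.swap.along_one_eq hq) h.isOpen hp,
    along_congr (fun q hq => h.along_one_eq hq) h.isOpen hp,
    along_smul h.swap.smooth_rotationCoeff h.smooth_one h.isOpen hp,
    along_smul h.smooth_rotationCoeff h.smooth_three h.isOpen hp] at h1
  have h2 := congrArg (fun v => inner ℝ v (along E₁ ψ p)) h1
  have h3 := congrArg (fun v => inner ℝ v (along E₃ ψ p)) h1
  simp only [inner_add_left, inner_smul_left, conj_trivial, h.inner_one_one hp,
    h.inner_one_three hp, h.inner_three_one hp, h.inner_three_three hp, h.inner_along_one_one hp,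
    h.swap.inner_along_one_one hp, h.inner_along_one_one_three hp,
    h.swap.inner_along_one_one_three hp] at h2 h3
  field_simp
  apply mul_left_cancel₀ hs
  linear_combination Real.cos (ω p) * h3 - h2 -
    along E₁ (rotationCoeff ψ η E₃ E₁) p * Real.sin_sq_add_cos_sq (ω p)

end IsRotatedNet

/-! ### The V-net lines -/

theorem norm_cross_eq_one {x y : Space} (hx : inner ℝ x x = (1 : ℝ)) (hy : inner ℝ y y = (1 : ℝ))
    (hxy : inner ℝ x y = (0 : ℝ)) : ‖cross x y‖ = 1 := by
  have h := inner_cross_cross x y x y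
  rw [hx, hy, hxy, real_inner_self_eq_norm_sq] at h
  exact (pow_eq_one_iff_of_nonneg (norm_nonneg _) two_ne_zero).mp (by linarith)

/-- The sign `|u|⁻¹ * u` of a nonvanishing continuous function is locally constant. -/
theorem eventually_abs_inv_mul_eq {u : ℝ → ℝ} {s : ℝ} (hu : ContinuousAt u s) (h0 : u s ≠ 0) :
    ∀ᶠ t in 𝓝 s, |u t|⁻¹ * u t = |u s|⁻¹ * u s := by
  rcases lt_or_gt_of_ne h0 with h | h
  · filter_upwards [hu.eventually_lt_const h] with t ht
    rw [abs_of_neg ht, abs_of_neg h, inv_neg, inv_neg, neg_mul, neg_mul, inv_mul_cancel₀ ht.ne,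
      inv_mul_cancel₀ h.ne]
  · filter_upwards [hu.eventually_const_lt h] with t ht
    rw [abs_of_pos ht, abs_of_pos h, inv_mul_cancel₀ ht.ne', inv_mul_cancel₀ h.ne']

namespace IsRotatedNet

variable {Ω : Set (ℝ × ℝ)} {ψ ν η : ℝ × ℝ → Space} {E₁ E₃ : ℝ × ℝ → ℝ × ℝ} {ω : ℝ × ℝ → ℝ}
  {p : ℝ × ℝ}

theorem vFrame_eq (h : IsRotatedNet Ω ψ ν η E₁ E₃ ω) (hp : p ∈ Ω) :
    vFrame η E₁ p = |rotationCoeff ψ η E₁ E₃ p|⁻¹ • E₁ p := by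
  change ‖along E₁ η p‖⁻¹ • E₁ p = _
  rw [h.along_one_eq hp, norm_smul, h.swap.norm_one hp, mul_one, Real.norm_eq_abs]

theorem triple_three_normal_along (h : IsRotatedNet Ω ψ ν η E₁ E₃ ω) {ε : ℝ}
    (hε : ∀ q ∈ Ω,
      inner ℝ (cross (along E₃ ψ q) (along E₁ ψ q)) (ν q) = ε * Real.sin (ω q)) (hp : p ∈ Ω) :
    inner ℝ (cross (along E₃ ψ p) (ν p)) (along E₁ ν p) = -(ε * Real.cos (ω p)) := by
  have hs := (h.sin_pos hp).ne'
  rw [h.along_normal hp, inner_smul_right, inner_sub_right, inner_smul_right,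
    inner_cross_self_left, ← inner_cross_rotate, inner_cross_swap, hε p hp]
  field_simp
  ring

/-- Along a V-net line of the first family `γ' = ± dψ (E₃)`, and `E₁ (dψ (E₃)) = sin ω ν` makes it
a geodesic. -/
theorem netLinesHave (h : IsRotatedNet Ω ψ ν η E₁ E₃ ω) {ε : ℝ}
    (hε : ∀ q ∈ Ω,
      inner ℝ (cross (along E₃ ψ q) (along E₁ ψ q)) (ν q) = ε * Real.sin (ω q)) :
    NetLinesHave η ν (vFrame η E₁) Ω
      (fun p => (rotationCoeff ψ η E₁ E₃ p)⁻¹ * Real.sin (ω p))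
      (fun p => -ε * ((rotationCoeff ψ η E₁ E₃ p)⁻¹ * Real.cos (ω p))) := by
  intro α s hs hα
  set c := rotationCoeff ψ η E₁ E₃ with hc
  set κ : ℝ × ℝ → ℝ := fun p => (c p)⁻¹ * Real.sin (ω p)
  set σ := |c (α s)|⁻¹ * c (α s) with hσ
  have hc0 : ∀ q ∈ Ω, c q ≠ 0 := fun q hq => h.rotationCoeff_ne_zero hq
  have hαs : ContinuousAt α s := hα.self_of_nhds.continuousAt
  have hcs : ContinuousAt (fun t => c (α t)) s :=
    ContinuousAt.comp (h.smooth_rotationCoeff.differentiableAt_of_isOpen h.isOpen hs).continuousAt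
      hαs
  -- near `s` the curve stays in `Ω` and the sign of `c` is constant
  have hev : ∀ᶠ t in 𝓝 s, α t ∈ Ω ∧ HasDerivAt α (|c (α t)|⁻¹ • E₁ (α t)) t ∧
      |c (α t)|⁻¹ * c (α t) = σ := by
    filter_upwards [hα, hαs.eventually (h.isOpen.mem_nhds hs),
      eventually_abs_inv_mul_eq hcs (hc0 _ hs)] with t h1 h2 h3
    refine ⟨h2, ?_, h3⟩
    rw [← h.vFrame_eq h2]
    exact h1
  have chain : ∀ {V : Type} [NormedAddCommGroup V] [NormedSpace ℝ V] {F : ℝ × ℝ → V}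
      (_ : ContDiffOn ℝ ∞ F Ω) {t : ℝ} (_ : α t ∈ Ω)
      (_ : HasDerivAt α (|c (α t)|⁻¹ • E₁ (α t)) t),
      HasDerivAt (fun r => F (α r)) (|c (α t)|⁻¹ • along E₁ F (α t)) t := by
    intro V _ _ F hF t h1 h2
    have := (hF.differentiableAt_of_isOpen h.isOpen h1).hasFDerivAt.comp_hasDerivAt t h2
    rwa [map_smul] at this
  have hσ2 : σ ^ 2 = 1 := by
    rw [hσ, mul_pow, inv_pow, sq_abs, inv_mul_cancel₀ (pow_ne_zero 2 (hc0 _ hs))]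
  -- the signed curvature has the factor `c⁻¹`: the sign of `γ'` times the speed factor `|c|⁻¹`
  have hσc : ∀ t, α t ∈ Ω → |c (α t)|⁻¹ * c (α t) = σ → σ * |c (α t)|⁻¹ = (c (α t))⁻¹ := by
    intro t h1 h2
    have h3 := hc0 _ h1
    have h4 : |c (α t)| ≠ 0 := abs_ne_zero.mpr h3
    rw [← h2]
    field_simp
    exact (sq_abs _).symm
  have d1 : ∀ᶠ t in 𝓝 s, deriv (η ∘ α) t = σ • along E₃ ψ (α t) := by
    filter_upwards [hev] with t ⟨h1, h2, h3⟩
    rw [← h3, mul_smul, hc, ← h.along_one_eq h1]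
    exact (chain h.vSurface.smooth h1 h2).deriv
  have d2 : ∀ᶠ t in 𝓝 s, deriv (deriv (η ∘ α)) t = κ (α t) • ν (α t) := by
    filter_upwards [hev, eventually_eventually_nhds.mpr d1] with t ⟨h1, h2, h3⟩ h4
    rw [Filter.EventuallyEq.deriv_eq h4]
    refine ((chain h.smooth_three h1 h2).const_smul σ).deriv.trans ?_
    rw [h.along_one_three h1, smul_smul, smul_smul, hσc t h1 h3]
  obtain ⟨-, e2, e3⟩ := hev.self_of_nhds
  have hκs : ContDiffOn ℝ ∞ κ Ω :=
    (h.smooth_rotationCoeff.inv hc0).mul (Real.contDiff_sin.comp_contDiffOn h.smooth_angle)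
  have d3 : deriv (deriv (deriv (η ∘ α))) s = κ (α s) • |c (α s)|⁻¹ • along E₁ ν (α s) +
      (|c (α s)|⁻¹ • along E₁ κ (α s)) • ν (α s) := by
    rw [Filter.EventuallyEq.deriv_eq d2]
    exact ((chain hκs hs e2).smul (chain h.smooth_normal hs e2)).deriv
  have hκ0 : κ (α s) ≠ 0 := mul_ne_zero (inv_ne_zero (hc0 _ hs)) (h.sin_pos hs).ne'
  have hn : ‖cross (along E₃ ψ (α s)) (ν (α s))‖ = 1 :=
    norm_cross_eq_one (h.inner_three_three hs) (h.kSurface.normal.inner_self hs)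
      (h.inner_three_normal hs)
  have hσ1 : |σ| = 1 := by rw [← sq_eq_sq₀ (abs_nonneg _) zero_le_one, sq_abs, hσ2, one_pow]
  have hspeed : ‖deriv (η ∘ α) s‖ = 1 := by
    rw [d1.self_of_nhds, norm_smul, h.swap.norm_one hs, Real.norm_eq_abs, hσ1, mul_one]
  have hcross : cross (deriv (η ∘ α) s) (deriv (deriv (η ∘ α)) s) =
      (σ * κ (α s)) • cross (along E₃ ψ (α s)) (ν (α s)) := by
    rw [d1.self_of_nhds, d2.self_of_nhds, cross_smul_left, cross_smul_right, smul_smul]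
  have hnorm : ‖cross (deriv (η ∘ α) s) (deriv (deriv (η ∘ α)) s)‖ = |κ (α s)| := by
    rw [hcross, norm_smul, hn, Real.norm_eq_abs, abs_mul, hσ1, one_mul, mul_one]
  refine ⟨hspeed, d2.self_of_nhds, ?_, ?_⟩
  · rw [curvature, hnorm, hspeed, one_pow, div_one]
  · change _ = -ε * ((c (α s))⁻¹ * Real.cos (ω (α s)))
    rw [torsion, hnorm, sq_abs, hcross, d3, inner_add_right, inner_smul_left, inner_smul_left,
      inner_smul_right, inner_smul_right, inner_smul_right, inner_cross_self_right,
      h.triple_three_normal_along hε hs, ← hσc s hs e3, conj_trivial, mul_zero,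
      mul_zero, add_zero, div_eq_iff (pow_ne_zero 2 hκ0)]
    ring

end IsRotatedNet

end VossSurface

theorem mainTheorem7
    (Ω : Set (ℝ × ℝ)) (ψ ν η : ℝ × ℝ → Space)
    (E₁ E₃ : ℝ × ℝ → ℝ × ℝ) (θ₁ θ₃ : ℝ × ℝ → (ℝ × ℝ) →L[ℝ] ℝ) (ω : ℝ × ℝ → ℝ)
    -- a K-surface, its K-frame, K-coframe and asymptotic angle
    (hK : IsKSurface ψ ν Ω)
    (hE : IsKFrame ψ ν E₁ E₃ Ω)
    (hθ : IsDualCoframe E₁ E₃ θ₁ θ₃ Ω)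
    (hω : ∀ p ∈ Ω, ω p = frameAngle ψ E₁ E₃ p)
    -- a V-surface that is a rotation field of the K-surface
    (hV : IsSurfaceElement η Ω)
    (hR : IsRotationField ψ η Ω) :
    IsUnitNormal η ν Ω ∧
    ∃ b c : ℝ × ℝ → ℝ,
      -- regularity, and the rotation operator
      ContDiffOn ℝ (⊤ : ℕ∞) b Ω ∧ ContDiffOn ℝ (⊤ : ℕ∞) c Ω ∧ ContDiffOn ℝ (⊤ : ℕ∞) ω Ω ∧
      (∀ p ∈ Ω, b p ≠ 0 ∧ c p ≠ 0 ∧ 0 < ω p ∧ ω p < Real.pi) ∧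
      (∀ p ∈ Ω, ∀ X : ℝ × ℝ,
        fderiv ℝ ψ p (rotationOperator ψ η p X) = fderiv ℝ η p X ∧
        rotationOperator ψ η p X = (b p * θ₃ p X) • E₁ p + (c p * θ₁ p X) • E₃ p) ∧
      -- first and second fundamental forms
      (∀ p ∈ Ω, ∀ X Y : ℝ × ℝ,
        firstForm η p X Y = c p ^ 2 * (θ₁ p X * θ₁ p Y)
          + 2 * (b p * c p) * Real.cos (ω p) * symProd (θ₁ p) (θ₃ p) X Y
          + b p ^ 2 * (θ₃ p X * θ₃ p Y)) ∧
      (∀ p ∈ Ω, ∀ X Y : ℝ × ℝ,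
        secondForm η ν p X Y = Real.sin (ω p) *
          (c p * (θ₁ p X * θ₁ p Y) + b p * (θ₃ p X * θ₃ p Y))) ∧
      -- Codazzi equations
      (∀ p ∈ Ω,
        -(fderiv ℝ b p (E₁ p)) = c p * (1 / Real.sin (ω p)) * fderiv ℝ ω p (E₃ p)
          + b p * (Real.cos (ω p) / Real.sin (ω p)) * fderiv ℝ ω p (E₁ p) ∧
        -(fderiv ℝ c p (E₃ p)) = c p * (Real.cos (ω p) / Real.sin (ω p)) * fderiv ℝ ω p (E₃ p)
          + b p * (1 / Real.sin (ω p)) * fderiv ℝ ω p (E₁ p)) ∧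
      -- Gauss (sine-Gordon) equation, which also reads `E₁ (E₃ ω) = sin ω`
      (∀ p ∈ Ω,
        hessian ψ ω E₁ E₃ p = Real.sin (ω p) ∧
        fderiv ℝ (fun q => fderiv ℝ ω q (E₃ q)) p (E₁ p) = Real.sin (ω p)) ∧
      -- curvatures and torsions of the V-net lines; `ε` is the orientation of `(e₃, e₁, ν)`,
      -- that is, of `(c⁻¹ dη (E₁), b⁻¹ dη (E₃), ν)`
      (∃ ε : ℝ, (ε = 1 ∨ ε = -1) ∧
        (∀ p ∈ Ω,
          0 < ε * inner ℝ (cross (fderiv ℝ ψ p (E₃ p)) (fderiv ℝ ψ p (E₁ p))) (ν p)) ∧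
        NetLinesHave η ν (vFrame η E₁) Ω
          (fun p => (c p)⁻¹ * Real.sin (ω p)) (fun p => -ε * ((c p)⁻¹ * Real.cos (ω p))) ∧
        NetLinesHave η ν (vFrame η E₃) Ω
          (fun p => (b p)⁻¹ * Real.sin (ω p)) (fun p => ε * ((b p)⁻¹ * Real.cos (ω p)))) ∧
      -- mean and Gaussian curvatures
      (∀ p ∈ Ω,
        meanCurvature η ν p = (b p + c p) / (2 * (b p * c p) * Real.sin (ω p)) ∧
        gaussCurvature η ν p = 1 / (b p * c p)) := by
  have h : IsRotatedNet Ω ψ ν η E₁ E₃ ω := ⟨⟨hK, hE, hω⟩, hV, hR⟩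
  obtain ⟨ε, hε1, hε⟩ := h.exists_orientation
  have hexp := fun p hp X => hθ.expand hp (hE.independent p hp) X
  have hinj := hK.surface.immersion
  refine ⟨h.isUnitNormal, rotationCoeff ψ η E₃ E₁, rotationCoeff ψ η E₁ E₃,
    h.swap.smooth_rotationCoeff, h.smooth_rotationCoeff, h.smooth_angle,
    fun p hp => ⟨h.swap.rotationCoeff_ne_zero hp, h.rotationCoeff_ne_zero hp,
      h.angle_mem_Ioo hp⟩, fun p hp X => ?_, fun p hp X Y => ?_, fun p hp X Y => ?_,
    fun p hp => ⟨h.codazzi hp, ?_⟩, fun p hp => ⟨?_, h.swap.sine_gordon hp⟩,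
    ⟨ε, hε1, fun p hp => ?_, h.netLinesHave hε, ?_⟩, fun p hp => h.curvatures hp⟩
  · have hX : fderiv ℝ η p X = fderiv ℝ ψ p ((rotationCoeff ψ η E₃ E₁ p * θ₃ p X) • E₁ p +
        (rotationCoeff ψ η E₁ E₃ p * θ₁ p X) • E₃ p) := by
      conv_lhs => rw [hexp p hp X]
      exact h.fderiv_eq hp _ _
    have hA := tangentPart_fderiv (hinj p hp) ((rotationCoeff ψ η E₃ E₁ p * θ₃ p X) • E₁ p +
        (rotationCoeff ψ η E₁ E₃ p * θ₁ p X) • E₃ p)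
    rw [← hX] at hA
    exact ⟨by rw [rotationOperator, hA, hX], hA⟩
  · conv_lhs => rw [hexp p hp X, hexp p hp Y]
    rw [h.firstForm_eq hp, symProd]
    ring
  · conv_lhs => rw [hexp p hp X, hexp p hp Y]
    exact h.secondForm_eq hp _ _ _ _
  · rw [add_comm]
    exact h.swap.codazzi hp
  · have hcov : covDeriv ψ E₁ E₃ p = 0 := by
      change tangentPart ψ p (along E₁ (along E₃ ψ) p) = 0
      rw [h.along_one_three hp]
      exact tangentPart_smul_normal hK.normal hp _
    rw [hessian, hcov, map_zero, sub_zero]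
    exact h.swap.sine_gordon hp
  · have h1 := hε p hp
    simp only [along] at h1
    rw [h1, ← mul_assoc]
    have hs := h.sin_pos hp
    rcases hε1 with rfl | rfl <;> simpa using hs
  · -- interchanging the two families reverses the orientation of the frame
    have hε' : ∀ q ∈ Ω, inner ℝ (cross (along E₁ ψ q) (along E₃ ψ q)) (ν q) =
        -ε * Real.sin (ω q) := fun q hq => by
      rw [inner_cross_swap, hε q hq, neg_mul]
    simpa only [neg_neg] using h.swap.netLinesHave hε'
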